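/- **Setting.** All graphs are finite. For a DAG $G$ let $\mathrm{Free}_G$ be the Markov category freely generated by the nodes of $G$ as objects and one box $\mathrm{pa}^G(a)\to a$ for every node $a$ as morphisms. A Markov functor is a strict symmetric monoidal functor between Markov categories that preserves copying and discarding; a causal model over $G$ is a Markov functor $F:\mathrm{Free}_G\to M$ into a Markov category $M$. Let $\mathrm{restr}(\mathrm{Free}_G)$ consist of the morphisms given by a string diagram in which every box appears at most once; such a morphism $X\to Y$ is called interventional (it represents $p(Y\mid do(X))$) if it is given by a string diagram in which every node is generated at most once, input wires being counted along with boxes. We say that a Markov functor $\iota:\mathrm{Free}_{H}\to\mathrm{Free}_{G}$ embeds $\mathrm{restr}(\mathrm{Free}_{H})$ into $\mathrm{restr}(\mathrm{Free}_{G})$ if it is injective on objects, maps $\mathrm{restr}(\mathrm{Free}_H)$ into $\mathrm{restr}(\mathrm{Free}_G)$ and interventional morphisms to interventional morphisms, and is injective on the interventional morphisms between any two objects. A DAG $H$ is a graphical abstraction of a DAG $G$ if it results from $G$ (up to renaming of nodes) by a sequence of the following operations: (a) deleting a node that does not have outgoing edges to two different nodes, and adding edges from all its parents to all its children; (b) merging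 two nodes, combining their incoming and their outgoing edges, provided that the result is acyclic. Every node $w$ of $H$ then comes from a cluster of nodes of $G$, namely those merged into $w$. Let $G$ be a DAG whose nodes are divided into endogenous nodes $V$ and exogenous nodes $U$, where exogenous nodes have no parents. The latent projection of $G$ is the acyclic directed mixed graph (ADMG) on $V$ with an edge $v\to w$ if $G$ has a directed path from $v$ to $w$ with all intermediate nodes in $U$, and an edge $v\leftrightarrow w$ ($v\ne w$) if some node of $U$ has directed paths to both $v$ and $w$ with all intermediate nodes in $U$. A causal model $F$ over $G$ is a causal model over the ADMG $L$ if the nodes of $G$ can be divided in this way so that $L$ is the latent projection of $G$. **Lemma.** Let $F_{L'}:\mathrm{Free}_{L'}\to M$ be a causal model over a DAG $L'$ with endogenous nodes $V$ and exogenous nodes $U$ that is a causal model over the ADMG $L$ on $V$, and let $H$ be an ADMG on a set $W$ that is a graphical abstraction between ADMGs of $L$, in the following sense: there are DAGs $L''$ and $H''$, with nodes divided into endogenous and exogenous ones, whose latent projections are $L$ and $H$, such that $H''$ is a graphical abstraction of $L''$, and 1. the exogenous nodes of $L''$ are never merged with other nodes in the sequence of operations leading from $L''$ to $H''$, and each $w\in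 W$ comes from a cluster $K(w)\subseteq V$ of endogenous nodes of $L''$; or 2. $L''=L'$ as DAGs, with no restriction on the operations or on the clusters $K(w)\subseteq V\sqcup U$ from which the nodes $w\in W$ come. Then, restricted to a subcategory of $\mathrm{Free}_{L'}$, $F_{L'}$ is a causal model over the ADMG $H$: there are a DAG $H'$ with endogenous nodes $W$ and (finitely many) exogenous nodes, with latent projection $H$, and a Markov functor $\iota:\mathrm{Free}_{H'}\to\mathrm{Free}_{L'}$ that embeds $\mathrm{restr}(\mathrm{Free}_{H'})$ into $\mathrm{restr}(\mathrm{Free}_{L'})$, such that for every $w\in W$ the nodes occurring in the tensor product $\iota(w)$ are exactly those of $K(w)$, and $F_{L'}\circ\iota$ is a causal model over the ADMG $H$. -/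

import Mathlib

open CategoryTheory MonoidalCategory ComonObj

universe u v₁ u₁ v₂ u₂ v₃ u₃

/-! ### Directed acyclic graphs -/

/-- A directed acyclic graph on `V`, given by its parent sets. -/
@[ext]
structure DAG (V : Type u) where
  /-- the set of parents of a node -/
  pa : V → Finset V
  acyclic : ∀ v, ¬ Relation.TransGen (fun x y => x ∈ pa y) v v

namespace DAG

variable {V W : Type u}

/-- There is an edge `x → y`. -/
def Adj (G : DAG V) (x y : V) : Prop := x ∈ G.pa y

/-- `H` arises from `G` by deleting the node `a`, which must not have two outgoing edges to
different nodes, and adding an edge from every parent of `a` to every child of `a`.  The map `e`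
names the remaining nodes. -/
structure IsDeletion (G : DAG V) (a : V) (H : DAG W) (e : W → V) : Prop where
  injective : Function.Injective e
  range_eq : Set.range e = {a}ᶜ
  not_confounder : ∀ x y, G.Adj a x → G.Adj a y → x = y
  adj_iff : ∀ w w', H.Adj w w' ↔
    G.Adj (e w) (e w') ∨ (G.Adj (e w) a ∧ G.Adj a (e w'))

/-- `H` arises from `G` by merging the two nodes `a` and `b`.  The map `f` sends a node of `G` to
the node of `H` that it becomes.  (`H` is a `DAG`, so a merge that creates a cycle is not valid.) -/
structure IsMerging (G : DAG V) (a b : V) (H : DAG W) (f : V → W) : Prop where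
  ne : a ≠ b
  surjective : Function.Surjective f
  eq_iff : ∀ x y, f x = f y ↔ x = y ∨ (x = a ∧ y = b) ∨ (x = b ∧ y = a)
  adj_iff : ∀ w w', H.Adj w w' ↔ w ≠ w' ∧ ∃ x y, f x = w ∧ f y = w' ∧ G.Adj x y

/-- `G.AbstractsTo X H cl`: the DAG `H` results from `G` by a sequence of deletions and mergings
(up to renaming of nodes) in which no node belonging to `X` is ever merged with another node;
`cl w` is the cluster of those nodes of `G` that have been merged into the node `w` of `H`.
For `X = ∅` there is no restriction, and `H` is an arbitrary graphical abstraction of `G`. -/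
inductive AbstractsTo (G : DAG V) (X : Set V) : {W : Type u} → DAG W → (W → Set V) → Prop
  | rename {W : Type u} (H : DAG W) (e : W ≃ V)
      (h : ∀ w w', H.Adj w w' ↔ G.Adj (e w) (e w')) :
      AbstractsTo G X H (fun w => {e w})
  | delete {W W' : Type u} {H : DAG W} {cl : W → Set V} {H' : DAG W'} (a : W) (e : W' → W)
      (hH : AbstractsTo G X H cl) (h : H.IsDeletion a H' e) :
      AbstractsTo G X H' (fun w => cl (e w))
  | merge {W W' : Type u} {H : DAG W} {cl : W → Set V} {H' : DAG W'} (a b : W) (f : W → W')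
      (hH : AbstractsTo G X H cl) (ha : Disjoint (cl a) X) (hb : Disjoint (cl b) X)
      (h : H.IsMerging a b H' f) :
      AbstractsTo G X H' (fun w => {n | ∃ x, f x = w ∧ n ∈ cl x})

end DAG

/-! ### Acyclic directed mixed graphs and latent projections -/

/-- An acyclic directed mixed graph on `V`. -/
@[ext]
structure ADMG (V : Type u) where
  /-- directed edges -/
  Dir : V → V → Prop
  /-- bidirected edges -/
  Bidir : V → V → Prop
  acyclic : ∀ v, ¬ Relation.TransGen Dir v v
  symm : ∀ v w, Bidir v w → Bidir w v
  irrefl : ∀ v, ¬ Bidir v v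

namespace DAG

variable {V U W : Type u}

/-- There is a directed path, with at least one edge, from `x` to the node `v ∈ V`, all of whose
intermediate nodes lie in `U`. -/
inductive LatentPath (G : DAG (V ⊕ U)) : V ⊕ U → V → Prop
  | edge {x : V ⊕ U} {v : V} (h : G.Adj x (Sum.inl v)) : LatentPath G x v
  | step {x : V ⊕ U} {w : U} {v : V} (h : G.Adj x (Sum.inr w))
      (p : LatentPath G (Sum.inr w) v) : LatentPath G x v

theorem LatentPath.transGen {G : DAG (V ⊕ U)} {x : V ⊕ U} {v : V} (h : G.LatentPath x v) :
    Relation.TransGen (fun a b => a ∈ G.pa b) x (Sum.inl v) := by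
  induction h with
  | edge h => exact .single h
  | step h _ ih => exact .head h ih

/-- The latent projection onto `V` of a DAG with nodes `V ⊔ U`: there is an edge `v → w` if there
is a directed path from `v` to `w` through `U`, and an edge `v ↔ w` if some node of `U` has directed
paths through `U` to both `v` and `w`. -/
def latentProjection (G : DAG (V ⊕ U)) : ADMG V where
  Dir v w := G.LatentPath (Sum.inl v) w
  Bidir v w := v ≠ w ∧ ∃ x : U, G.LatentPath (Sum.inr x) v ∧ G.LatentPath (Sum.inr x) w
  acyclic v h := by
    refine G.acyclic (Sum.inl v) ?_
    have key : ∀ a b : V, Relation.TransGen (fun v w => G.LatentPath (Sum.inl v) w) a b →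
        Relation.TransGen (fun a b => a ∈ G.pa b) (Sum.inl a) (Sum.inl b) := by
      intro a b hab
      induction hab with
      | single h => exact h.transGen
      | tail _ h ih => exact ih.trans h.transGen
    exact key v v h
  symm := fun _ _ h => ⟨h.1.symm, h.2.imp fun _ hx => ⟨hx.2, hx.1⟩⟩
  irrefl := fun _ h => h.1 rfl

/-- The nodes of the DAG `G` are divided into endogenous nodes `V` and exogenous (that is,
parentless) nodes `U`, and the ADMG `L` is its latent projection onto `V`. -/
structure Represents (G : DAG (V ⊕ U)) (L : ADMG V) : Prop where
  exogenous : ∀ x : U, G.pa (Sum.inr x) = ∅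
  latentProjection_eq : G.latentProjection = L

end DAG

/-- `H` is a graphical abstraction between ADMGs of `L`: there are DAGs `L₁`, `H₁` with latent
projections `L`, `H` such that `H₁` is a graphical abstraction of `L₁`, where exogenous nodes are
never merged and the node `w` of `H` is obtained from the cluster `K w` of nodes of `L`. -/
def ADMG.IsGraphicalAbstraction {V W : Type u} (L : ADMG V) (H : ADMG W) (K : W → Set V) : Prop :=
  ∃ (U₁ U₂ : Type u) (_ : Finite U₁) (_ : Finite U₂) (L₁ : DAG (V ⊕ U₁)) (H₁ : DAG (W ⊕ U₂))
    (cl : W ⊕ U₂ → Set (V ⊕ U₁)),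
    L₁.Represents L ∧ H₁.Represents H ∧ L₁.AbstractsTo (Set.range Sum.inr) H₁ cl ∧
      ∀ w, cl (Sum.inl w) = Sum.inl '' K w

/-- The ADMG `H` is the latent projection of some graphical abstraction of the DAG `G`, with no
restriction on the mergings; the node `w` of `H` is obtained from the cluster `K w` of nodes
of `G`. -/
def DAG.HasADMGAbstraction {V W : Type u} (G : DAG V) (H : ADMG W) (K : W → Set V) : Prop :=
  ∃ (U₂ : Type u) (_ : Finite U₂) (H₁ : DAG (W ⊕ U₂)) (cl : W ⊕ U₂ → Set V),
    H₁.Represents H ∧ G.AbstractsTo ∅ H₁ cl ∧ ∀ w, cl (Sum.inl w) = K w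

/-! ### Markov functors -/

/-- A Markov functor: a strict symmetric monoidal functor between Markov categories that preserves
copying and discarding.  Strictness means that the structure morphisms are identities. -/
structure MarkovFunctor (C : Type u₁) [Category.{v₁} C] [MonoidalCategory.{v₁} C]
    [MarkovCategory C] (D : Type u₂) [Category.{v₂} D] [MonoidalCategory.{v₂} D]
    [MarkovCategory D] where
  /-- the underlying functor -/
  toFunctor : C ⥤ D
  /-- its symmetric monoidal structure -/
  [braided : toFunctor.Braided]
  obj_unit : 𝟙_ D = toFunctor.obj (𝟙_ C)
  obj_tensor : ∀ X Y : C, toFunctor.obj X ⊗ toFunctor.obj Y = toFunctor.obj (X ⊗ Y)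
  unit_eq : Functor.LaxMonoidal.ε toFunctor = eqToHom obj_unit
  tensor_eq : ∀ X Y : C, Functor.LaxMonoidal.μ toFunctor X Y = eqToHom (obj_tensor X Y)
  map_copy : ∀ X : C,
    toFunctor.map Δ[X] = Δ[toFunctor.obj X] ≫ Functor.LaxMonoidal.μ toFunctor X X
  map_discard : ∀ X : C,
    toFunctor.map ε[X] = ε[toFunctor.obj X] ≫ Functor.LaxMonoidal.ε toFunctor

attribute [instance] MarkovFunctor.braided

namespace MarkovFunctor

variable {C : Type u₁} [Category.{v₁} C] [MonoidalCategory.{v₁} C] [MarkovCategory C]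
  {D : Type u₂} [Category.{v₂} D] [MonoidalCategory.{v₂} D] [MarkovCategory D]
  {E : Type u₃} [Category.{v₃} E] [MonoidalCategory.{v₃} E] [MarkovCategory E]

/-- Composition of Markov functors. -/
def comp (F : MarkovFunctor C D) (G : MarkovFunctor D E) : MarkovFunctor C E where
  toFunctor := F.toFunctor ⋙ G.toFunctor
  obj_unit := G.obj_unit.trans (congrArg _ F.obj_unit)
  obj_tensor X Y := (G.obj_tensor _ _).trans (congrArg _ (F.obj_tensor X Y))
  unit_eq := by simp [F.unit_eq, G.unit_eq, eqToHom_map]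
  tensor_eq X Y := by simp [F.tensor_eq, G.tensor_eq, eqToHom_map]
  map_copy X := by simp [F.map_copy, G.map_copy]
  map_discard X := by simp [F.map_discard, G.map_discard]

end MarkovFunctor

/-! ### The free Markov category of a DAG -/

/-- The objects of the Markov category freely generated by a DAG: formal tensor products of
nodes. -/
inductive FreeMarkov {V : Type u} (G : DAG V) : Type u
  | of (v : V) : FreeMarkov G
  | unit : FreeMarkov G
  | tensor (X Y : FreeMarkov G) : FreeMarkov G

namespace FreeMarkov

variable {V : Type u} {G : DAG V}

/-- The nodes occurring in a formal tensor product, from left to right. -/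
def nodes : FreeMarkov G → List V
  | of v => [v]
  | unit => []
  | tensor X Y => nodes X ++ nodes Y

/-- The formal tensor product of a list of nodes. -/
def tensorList (G : DAG V) : List V → FreeMarkov G
  | [] => unit
  | v :: l => tensor (of v) (tensorList G l)

/-- String diagrams over a DAG, as formal composites of the structure morphisms of a Markov
category and of one generating box `pa(a) → a` for every node `a`. -/
inductive Diagram (G : DAG V) : FreeMarkov G → FreeMarkov G → Type u
  | box (a : V) : Diagram G (tensorList G (G.pa a).toList) (of a)
  | id (X) : Diagram G X X
  | comp {X Y Z} (f : Diagram G X Y) (g : Diagram G Y Z) : Diagram G X Z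
  | whiskerLeft (X) {Y Z} (f : Diagram G Y Z) : Diagram G (tensor X Y) (tensor X Z)
  | whiskerRight {X Y} (f : Diagram G X Y) (Z) : Diagram G (tensor X Z) (tensor Y Z)
  | assoc (X Y Z) : Diagram G (tensor (tensor X Y) Z) (tensor X (tensor Y Z))
  | assocInv (X Y Z) : Diagram G (tensor X (tensor Y Z)) (tensor (tensor X Y) Z)
  | leftUnit (X) : Diagram G (tensor unit X) X
  | leftUnitInv (X) : Diagram G X (tensor unit X)
  | rightUnit (X) : Diagram G (tensor X unit) X
  | rightUnitInv (X) : Diagram G X (tensor X unit)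
  | swap (X Y) : Diagram G (tensor X Y) (tensor Y X)
  | copy (X) : Diagram G X (tensor X X)
  | discard (X) : Diagram G X unit

namespace Diagram

/-- The generating boxes (labelled by nodes) occurring in a diagram, with multiplicity. -/
def boxes : {X Y : FreeMarkov G} → Diagram G X Y → List V
  | _, _, box a => [a]
  | _, _, comp f g => boxes f ++ boxes g
  | _, _, whiskerLeft _ f => boxes f
  | _, _, whiskerRight f _ => boxes f
  | _, _, id _ => []
  | _, _, assoc _ _ _ => []
  | _, _, assocInv _ _ _ => []
  | _, _, leftUnit _ => []
  | _, _, leftUnitInv _ => []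
  | _, _, rightUnit _ => []
  | _, _, rightUnitInv _ => []
  | _, _, swap _ _ => []
  | _, _, copy _ => []
  | _, _, discard _ => []

/-- The middle-four interchange `(X₁ ⊗ X₂) ⊗ (Y₁ ⊗ Y₂) → (X₁ ⊗ Y₁) ⊗ (X₂ ⊗ Y₂)`. -/
def middleSwap (X₁ X₂ Y₁ Y₂ : FreeMarkov G) :
    Diagram G (tensor (tensor X₁ X₂) (tensor Y₁ Y₂)) (tensor (tensor X₁ Y₁) (tensor X₂ Y₂)) :=
  (assoc X₁ X₂ (tensor Y₁ Y₂)).comp <|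
    (whiskerLeft X₁ (assocInv X₂ Y₁ Y₂)).comp <|
      (whiskerLeft X₁ (whiskerRight (swap X₂ Y₁) Y₂)).comp <|
        (whiskerLeft X₁ (assoc Y₁ X₂ Y₂)).comp (assocInv X₁ Y₁ (tensor X₂ Y₂))

/-- Equality of string diagrams: the congruence generated by the axioms of a Markov category. -/
inductive Rel : {X Y : FreeMarkov G} → Diagram G X Y → Diagram G X Y → Prop
  -- equivalence relation and congruence
  | refl {X Y} (f : Diagram G X Y) : Rel f f
  | symm {X Y} {f g : Diagram G X Y} : Rel f g → Rel g f
  | trans {X Y} {f g h : Diagram G X Y} : Rel f g → Rel g h → Rel f h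
  | comp {X Y Z} {f f' : Diagram G X Y} {g g' : Diagram G Y Z} :
      Rel f f' → Rel g g' → Rel (f.comp g) (f'.comp g')
  | whiskerLeft (X) {Y Z} {f f' : Diagram G Y Z} :
      Rel f f' → Rel (f.whiskerLeft X) (f'.whiskerLeft X)
  | whiskerRight {X Y} {f f' : Diagram G X Y} (Z) :
      Rel f f' → Rel (f.whiskerRight Z) (f'.whiskerRight Z)
  -- category
  | id_comp {X Y} (f : Diagram G X Y) : Rel ((id X).comp f) f
  | comp_id {X Y} (f : Diagram G X Y) : Rel (f.comp (id Y)) f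
  | comp_assoc {W X Y Z} (f : Diagram G W X) (g : Diagram G X Y) (h : Diagram G Y Z) :
      Rel ((f.comp g).comp h) (f.comp (g.comp h))
  -- bifunctoriality of the tensor product
  | whiskerLeft_id (X Y) : Rel ((id Y).whiskerLeft X) (id (tensor X Y))
  | id_whiskerRight (X Y) : Rel ((id X).whiskerRight Y) (id (tensor X Y))
  | whiskerLeft_comp (W) {X Y Z} (f : Diagram G X Y) (g : Diagram G Y Z) :
      Rel ((f.comp g).whiskerLeft W) ((f.whiskerLeft W).comp (g.whiskerLeft W))
  | comp_whiskerRight {W X Y} (f : Diagram G W X) (g : Diagram G X Y) (Z) :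
      Rel ((f.comp g).whiskerRight Z) ((f.whiskerRight Z).comp (g.whiskerRight Z))
  | exchange {W X Y Z} (f : Diagram G W X) (g : Diagram G Y Z) :
      Rel ((g.whiskerLeft W).comp (f.whiskerRight Z)) ((f.whiskerRight Y).comp (g.whiskerLeft X))
  -- associator and unitors
  | assoc_hom_inv (X Y Z) : Rel ((assoc X Y Z).comp (assocInv X Y Z)) (id _)
  | assoc_inv_hom (X Y Z) : Rel ((assocInv X Y Z).comp (assoc X Y Z)) (id _)
  | leftUnit_hom_inv (X) : Rel ((leftUnit X).comp (leftUnitInv X)) (id _)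
  | leftUnit_inv_hom (X) : Rel ((leftUnitInv X).comp (leftUnit X)) (id _)
  | rightUnit_hom_inv (X) : Rel ((rightUnit X).comp (rightUnitInv X)) (id _)
  | rightUnit_inv_hom (X) : Rel ((rightUnitInv X).comp (rightUnit X)) (id _)
  | assoc_nat_left {X X'} (f : Diagram G X X') (Y Z) :
      Rel (((f.whiskerRight Y).whiskerRight Z).comp (assoc X' Y Z))
        ((assoc X Y Z).comp (f.whiskerRight (tensor Y Z)))
  | assoc_nat_middle (X) {Y Y'} (f : Diagram G Y Y') (Z) :
      Rel (((f.whiskerLeft X).whiskerRight Z).comp (assoc X Y' Z))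
        ((assoc X Y Z).comp ((f.whiskerRight Z).whiskerLeft X))
  | assoc_nat_right (X Y) {Z Z'} (f : Diagram G Z Z') :
      Rel ((f.whiskerLeft (tensor X Y)).comp (assoc X Y Z'))
        ((assoc X Y Z).comp ((f.whiskerLeft Y).whiskerLeft X))
  | leftUnit_nat {X Y} (f : Diagram G X Y) :
      Rel ((f.whiskerLeft unit).comp (leftUnit Y)) ((leftUnit X).comp f)
  | rightUnit_nat {X Y} (f : Diagram G X Y) :
      Rel ((f.whiskerRight unit).comp (rightUnit Y)) ((rightUnit X).comp f)
  | pentagon (W X Y Z) :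
      Rel (((assoc W X Y).whiskerRight Z).comp
          ((assoc W (tensor X Y) Z).comp ((assoc X Y Z).whiskerLeft W)))
        ((assoc (tensor W X) Y Z).comp (assoc W X (tensor Y Z)))
  | triangle (X Y) :
      Rel ((assoc X unit Y).comp ((leftUnit Y).whiskerLeft X)) ((rightUnit X).whiskerRight Y)
  -- symmetry
  | swap_swap (X Y) : Rel ((swap X Y).comp (swap Y X)) (id _)
  | swap_nat_right (X) {Y Z} (f : Diagram G Y Z) :
      Rel ((f.whiskerLeft X).comp (swap X Z)) ((swap X Y).comp (f.whiskerRight X))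
  | swap_nat_left {X Y} (f : Diagram G X Y) (Z) :
      Rel ((f.whiskerRight Z).comp (swap Y Z)) ((swap X Z).comp (f.whiskerLeft Z))
  | hexagon_forward (X Y Z) :
      Rel ((assoc X Y Z).comp ((swap X (tensor Y Z)).comp (assoc Y Z X)))
        (((swap X Y).whiskerRight Z).comp ((assoc Y X Z).comp ((swap X Z).whiskerLeft Y)))
  | hexagon_reverse (X Y Z) :
      Rel ((assocInv X Y Z).comp ((swap (tensor X Y) Z).comp (assocInv Z X Y)))
        (((swap Y Z).whiskerLeft X).comp ((assocInv X Z Y).comp ((swap X Z).whiskerRight Y)))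
  -- commutative comonoids
  | copy_discard_left (X) : Rel ((copy X).comp ((discard X).whiskerRight X)) (leftUnitInv X)
  | copy_discard_right (X) : Rel ((copy X).comp ((discard X).whiskerLeft X)) (rightUnitInv X)
  | copy_assoc (X) :
      Rel ((copy X).comp ((copy X).whiskerLeft X))
        ((copy X).comp (((copy X).whiskerRight X).comp (assoc X X X)))
  | copy_swap (X) : Rel ((copy X).comp (swap X X)) (copy X)
  -- compatibility of the comonoids with the tensor product
  | copy_tensor (X Y) :
      Rel (copy (tensor X Y))
        ((((copy X).whiskerRight Y).comp ((copy Y).whiskerLeft (tensor X X))).comp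
          (middleSwap X X Y Y))
  | discard_tensor (X Y) :
      Rel (discard (tensor X Y))
        ((((discard X).whiskerRight Y).comp ((discard Y).whiskerLeft unit)).comp (leftUnit unit))
  | copy_unit : Rel (copy (G := G) unit) (leftUnitInv unit)
  | discard_unit : Rel (discard (G := G) unit) (id unit)
  -- the unit is terminal
  | discard_nat {X Y} (f : Diagram G X Y) : Rel (f.comp (discard Y)) (discard X)

instance setoid (X Y : FreeMarkov G) : Setoid (Diagram G X Y) :=
  ⟨Rel, Rel.refl, Rel.symm, Rel.trans⟩

end Diagram

open Diagram

instance : Category.{u} (FreeMarkov G) where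
  Hom X Y := Quotient (Diagram.setoid X Y)
  id X := ⟦Diagram.id X⟧
  comp f g := Quotient.map₂ Diagram.comp (fun _ _ h _ _ h' => Rel.comp h h') f g
  id_comp := by rintro X Y ⟨f⟩; exact Quotient.sound (Rel.id_comp f)
  comp_id := by rintro X Y ⟨f⟩; exact Quotient.sound (Rel.comp_id f)
  assoc := by rintro W X Y Z ⟨f⟩ ⟨g⟩ ⟨h⟩; exact Quotient.sound (Rel.comp_assoc f g h)

/-- The morphism of the free Markov category given by a string diagram. -/
def homMk {X Y : FreeMarkov G} (f : Diagram G X Y) : X ⟶ Y := Quotient.mk _ f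

theorem homMk_sound {X Y : FreeMarkov G} {f g : Diagram G X Y} (h : Rel f g) :
    homMk f = homMk g := Quotient.sound h

theorem homMk_comp {X Y Z : FreeMarkov G} (f : Diagram G X Y) (g : Diagram G Y Z) :
    homMk (f.comp g) = homMk f ≫ homMk g := rfl

instance : MonoidalCategoryStruct (FreeMarkov G) where
  tensorObj := tensor
  tensorUnit := unit
  whiskerLeft X _ _ f :=
    Quotient.map (Diagram.whiskerLeft X) (fun _ _ h => Rel.whiskerLeft X h) f
  whiskerRight f Z :=
    Quotient.map (fun d => Diagram.whiskerRight d Z) (fun _ _ h => Rel.whiskerRight Z h) f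
  associator X Y Z := ⟨homMk (Diagram.assoc X Y Z), homMk (assocInv X Y Z),
    homMk_sound (Rel.assoc_hom_inv X Y Z), homMk_sound (Rel.assoc_inv_hom X Y Z)⟩
  leftUnitor X := ⟨homMk (leftUnit X), homMk (leftUnitInv X),
    homMk_sound (Rel.leftUnit_hom_inv X), homMk_sound (Rel.leftUnit_inv_hom X)⟩
  rightUnitor X := ⟨homMk (rightUnit X), homMk (rightUnitInv X),
    homMk_sound (Rel.rightUnit_hom_inv X), homMk_sound (Rel.rightUnit_inv_hom X)⟩

instance : MonoidalCategory (FreeMarkov G) where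
  tensorHom_def _ _ := rfl
  id_tensorHom_id X Y :=
    homMk_sound (((Rel.id_whiskerRight X Y).comp (Rel.whiskerLeft_id X Y)).trans (Rel.id_comp _))
  tensorHom_comp_tensorHom := by
    rintro X₁ Y₁ Z₁ X₂ Y₂ Z₂ ⟨f₁⟩ ⟨f₂⟩ ⟨g₁⟩ ⟨g₂⟩
    refine homMk_sound (f := ((f₁.whiskerRight X₂).comp (f₂.whiskerLeft Y₁)).comp
      ((g₁.whiskerRight Y₂).comp (g₂.whiskerLeft Z₁)))
      (g := ((f₁.comp g₁).whiskerRight X₂).comp ((f₂.comp g₂).whiskerLeft Z₁)) ?_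
    refine Rel.trans ?_ (Rel.comp (Rel.comp_whiskerRight f₁ g₁ X₂)
      (Rel.whiskerLeft_comp Z₁ f₂ g₂)).symm
    refine (Rel.comp_assoc _ _ _).trans (Rel.trans ?_ (Rel.comp_assoc _ _ _).symm)
    refine (Rel.refl _).comp ?_
    refine (Rel.comp_assoc _ _ _).symm.trans (Rel.trans ?_ (Rel.comp_assoc _ _ _))
    exact (Rel.exchange g₁ f₂).comp (Rel.refl _)
  whiskerLeft_id X Y := homMk_sound (Rel.whiskerLeft_id X Y)
  id_whiskerRight X Y := homMk_sound (Rel.id_whiskerRight X Y)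
  associator_naturality := by
    rintro X₁ X₂ X₃ Y₁ Y₂ Y₃ ⟨f₁⟩ ⟨f₂⟩ ⟨f₃⟩
    refine homMk_sound
      (f := ((((f₁.whiskerRight X₂).comp (f₂.whiskerLeft Y₁)).whiskerRight X₃).comp
        (f₃.whiskerLeft (tensor Y₁ Y₂))).comp (Diagram.assoc Y₁ Y₂ Y₃))
      (g := (Diagram.assoc X₁ X₂ X₃).comp ((f₁.whiskerRight (tensor X₂ X₃)).comp
        (((f₂.whiskerRight X₃).comp (f₃.whiskerLeft Y₂)).whiskerLeft Y₁))) ?_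
    refine (Rel.comp_assoc _ _ _).trans ?_
    refine (Rel.comp (Rel.comp_whiskerRight _ _ _) (Rel.assoc_nat_right Y₁ Y₂ f₃)).trans ?_
    refine (Rel.comp_assoc _ _ _).trans ?_
    refine ((Rel.refl _).comp ((Rel.comp_assoc _ _ _).symm.trans
      (((Rel.assoc_nat_middle Y₁ f₂ X₃).comp (Rel.refl _)).trans (Rel.comp_assoc _ _ _)))).trans ?_
    refine (Rel.comp_assoc _ _ _).symm.trans ?_
    refine ((Rel.assoc_nat_left f₁ X₂ X₃).comp (Rel.whiskerLeft_comp _ _ _).symm).trans ?_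
    exact Rel.comp_assoc _ _ _
  leftUnitor_naturality := by rintro X Y ⟨f⟩; exact homMk_sound (Rel.leftUnit_nat f)
  rightUnitor_naturality := by rintro X Y ⟨f⟩; exact homMk_sound (Rel.rightUnit_nat f)
  pentagon W X Y Z := homMk_sound (Rel.pentagon W X Y Z)
  triangle X Y := homMk_sound (Rel.triangle X Y)

instance : SymmetricCategory (FreeMarkov G) where
  braiding X Y := ⟨homMk (swap X Y), homMk (swap Y X),
    homMk_sound (Rel.swap_swap X Y), homMk_sound (Rel.swap_swap Y X)⟩
  braiding_naturality_right := by rintro X Y Z ⟨f⟩; exact homMk_sound (Rel.swap_nat_right X f)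
  braiding_naturality_left := by rintro X Y ⟨f⟩ Z; exact homMk_sound (Rel.swap_nat_left f Z)
  hexagon_forward X Y Z := homMk_sound (Rel.hexagon_forward X Y Z)
  hexagon_reverse X Y Z := homMk_sound (Rel.hexagon_reverse X Y Z)
  symmetry X Y := homMk_sound (Rel.swap_swap X Y)

instance (X : FreeMarkov G) : ComonObj X where
  counit := homMk (discard X)
  comul := homMk (copy X)
  counit_comul := homMk_sound (Rel.copy_discard_left X)
  comul_counit := homMk_sound (Rel.copy_discard_right X)
  comul_assoc := homMk_sound (Rel.copy_assoc X)

instance (X : FreeMarkov G) : IsCommComonObj X where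
  comul_comm := homMk_sound (Rel.copy_swap X)

/-- `FreeMarkov G` is the Markov category freely generated by the nodes of `G` as objects and the
boxes `pa(a) → a` as morphisms. -/
instance : MarkovCategory (FreeMarkov G) where
  copy_tensor X Y := homMk_sound (Rel.copy_tensor X Y)
  discard_tensor X Y := homMk_sound (Rel.discard_tensor X Y)
  copy_unit := homMk_sound Rel.copy_unit
  discard_unit := homMk_sound Rel.discard_unit
  discard_natural := by rintro X Y ⟨f⟩; exact homMk_sound (Rel.discard_nat f)

/-- `f` is given by a string diagram in which every generating box appears at most once. -/
def UsesBoxesOnce {X Y : FreeMarkov G} (f : X ⟶ Y) : Prop :=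
  ∃ d : Diagram G X Y, homMk d = f ∧ d.boxes.Nodup

/-- `f` is (the string diagram of) a type of interventional distribution `p(Y | do(X))`: it is
given by a string diagram in which every node is generated at most once, either as an input wire
or by its generating box. -/
def IsInterventional {X Y : FreeMarkov G} (f : X ⟶ Y) : Prop :=
  ∃ d : Diagram G X Y, homMk d = f ∧ (X.nodes ++ d.boxes).Nodup

end FreeMarkov

/-- The Markov functor `ι` embeds the restriction of `FreeMarkov H` to the diagrams in which every
box appears at most once into that of `FreeMarkov G`: it is injective on objects, it preserves such
diagrams and the interventional ones, and it is injective on interventional diagrams. -/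
structure MarkovFunctor.EmbedsRestr {V W : Type u} {H : DAG W} {G : DAG V}
    (ι : MarkovFunctor (FreeMarkov H) (FreeMarkov G)) : Prop where
  obj_injective : Function.Injective ι.toFunctor.obj
  map_usesBoxesOnce : ∀ {X Y : FreeMarkov H} (f : X ⟶ Y),
    FreeMarkov.UsesBoxesOnce f → FreeMarkov.UsesBoxesOnce (ι.toFunctor.map f)
  map_interventional : ∀ {X Y : FreeMarkov H} (f : X ⟶ Y),
    FreeMarkov.IsInterventional f → FreeMarkov.IsInterventional (ι.toFunctor.map f)
  injOn_interventional : ∀ {X Y : FreeMarkov H} (f g : X ⟶ Y),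
    FreeMarkov.IsInterventional f → FreeMarkov.IsInterventional g →
      ι.toFunctor.map f = ι.toFunctor.map g → f = g

/-! ### Causal models -/

/-- A causal model over the DAG `G` with values in the Markov category `M`. -/
abbrev CausalModel {V : Type u} (G : DAG V) (M : Type u₁) [Category.{v₁} M]
    [MonoidalCategory.{v₁} M] [MarkovCategory M] :=
  MarkovFunctor (FreeMarkov G) M

namespace CausalModel

variable {V U W : Type u} {M : Type u₁} [Category.{v₁} M] [MonoidalCategory.{v₁} M]
  [MarkovCategory M]

/-- The causal model `F` over the DAG `G`, whose nodes are divided into endogenous nodes `V` and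
exogenous nodes `U`, is a causal model over the ADMG `L`. -/
def IsOverADMG {G : DAG (V ⊕ U)} (_F : CausalModel G M) (L : ADMG V) : Prop :=
  G.Represents L

/-- The restriction of the causal model `F` along a Markov functor `ι`. -/
def restrict {G : DAG V} {H : DAG W} (F : CausalModel G M)
    (ι : MarkovFunctor (FreeMarkov H) (FreeMarkov G)) : CausalModel H M :=
  ι.comp F

end CausalModel

/-!
An interventional morphism is determined by its domain and codomain: the truncated factorization
of `p(Y | do(X))`. A functor which is injective on objects and preserves interventional morphisms
is therefore injective on them.

To embed `H'` into `L'`, give every node of `H'` besides its cluster a *territory*, such that the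
territories are pairwise disjoint and contain the parents of their nodes up to the clusters of the
parents in `H'`. The functor sends a box of `H'` to the diagram which generates every node of the
territory once and marginalizes to the cluster. Territories exist for every graphical abstraction:
the territory of a deleted node is annexed by that of its only child, and merged nodes unite theirs.

If the exogenous nodes are not merged, then territories in `L''` depend only on `L` as far as
endogenous nodes are concerned, so they can be transferred to `L'`, and the exogenous nodes of `L'`
take over the role of the others.
-/

namespace MarkovPairing

variable {C : Type u₁} [Category.{v₁} C] [MonoidalCategory.{v₁} C] [MarkovCategory C]
  {W X Y Z A B : C}

/-- The pairing of `f` and `g`: copy the input and apply `f` and `g` to the two copies. -/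
def pair (f : X ⟶ Y) (g : X ⟶ Z) : X ⟶ Y ⊗ Z := Δ[X] ≫ (f ⊗ₘ g)

/-- The first projection, which discards the second factor. -/
def fst (X Y : C) : X ⊗ Y ⟶ X := X ◁ ε[Y] ≫ (ρ_ X).hom

/-- The second projection, which discards the first factor. -/
def snd (X Y : C) : X ⊗ Y ⟶ Y := ε[X] ▷ Y ≫ (λ_ Y).hom

theorem pair_comp_tensorHom (f : X ⟶ Y) (g : X ⟶ Z) (h : Y ⟶ A) (k : Z ⟶ B) :
    pair f g ≫ (h ⊗ₘ k) = pair (f ≫ h) (g ≫ k) := by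
  simp [pair]

theorem pair_comp_whiskerLeft (f : X ⟶ Y) (g : X ⟶ Z) (k : Z ⟶ B) :
    pair f g ≫ Y ◁ k = pair f (g ≫ k) := by
  rw [← id_tensorHom, pair_comp_tensorHom, Category.comp_id]

theorem pair_comp_whiskerRight (f : X ⟶ Y) (g : X ⟶ Z) (h : Y ⟶ A) :
    pair f g ≫ h ▷ Z = pair (f ≫ h) g := by
  rw [← tensorHom_id, pair_comp_tensorHom, Category.comp_id]

theorem pair_discard_comp_rightUnitor (f : X ⟶ Y) : pair f ε[X] ≫ (ρ_ Y).hom = f := by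
  simp [pair]

theorem pair_discard_comp_leftUnitor (f : X ⟶ Y) : pair ε[X] f ≫ (λ_ Y).hom = f := by
  simp [pair]

theorem pair_comp_fst (f : X ⟶ Y) (g : X ⟶ Z) : pair f g ≫ fst Y Z = f := by
  rw [fst, ← Category.assoc, pair_comp_whiskerLeft, MarkovCategory.discard_natural,
    pair_discard_comp_rightUnitor]

theorem pair_comp_snd (f : X ⟶ Y) (g : X ⟶ Z) : pair f g ≫ snd Y Z = g := by
  rw [snd, ← Category.assoc, pair_comp_whiskerRight, MarkovCategory.discard_natural,
    pair_discard_comp_leftUnitor]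

theorem pair_comp_braiding (f : X ⟶ Y) (g : X ⟶ Z) : pair f g ≫ (β_ Y Z).hom = pair g f := by
  rw [pair, pair, Category.assoc, BraidedCategory.braiding_naturality,
    IsCommComonObj.comul_comm_assoc]

theorem pair_comp_associator (f : X ⟶ Y) (g : X ⟶ Z) (h : X ⟶ A) :
    pair (pair f g) h ≫ (α_ Y Z A).hom = pair f (pair g h) := by
  have expand_left : pair (pair f g) h = Δ[X] ≫ Δ[X] ▷ X ≫ ((f ⊗ₘ g) ⊗ₘ h) := by
    rw [pair, pair, ← tensorHom_id, tensorHom_comp_tensorHom, Category.id_comp]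
  have expand_right : pair f (pair g h) = Δ[X] ≫ X ◁ Δ[X] ≫ (f ⊗ₘ g ⊗ₘ h) := by
    rw [pair, pair, ← id_tensorHom, tensorHom_comp_tensorHom, Category.id_comp]
  simp only [expand_left, expand_right, Category.assoc, associator_naturality, comul_assoc_assoc]

theorem pair_comp_associator_inv (f : X ⟶ Y) (g : X ⟶ Z) (h : X ⟶ A) :
    pair f (pair g h) ≫ (α_ Y Z A).inv = pair (pair f g) h := by
  rw [← pair_comp_associator, Category.assoc, Iso.hom_inv_id, Category.comp_id]

theorem pair_comp_tensorμ (f : X ⟶ Y) (g : X ⟶ Z) (h : X ⟶ A) (k : X ⟶ B) :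
    pair (pair f g) (pair h k) ≫ tensorμ Y Z A B = pair (pair f h) (pair g k) := by
  simp only [tensorμ, reassoc_of% pair_comp_associator, reassoc_of% @pair_comp_whiskerLeft,
    pair_comp_associator_inv, pair_comp_whiskerRight, pair_comp_braiding, pair_comp_associator]

theorem pair_id_id_tensor (X Y : C) :
    pair (𝟙 (X ⊗ Y)) (𝟙 (X ⊗ Y)) =
      (pair (𝟙 X) (𝟙 X) ⊗ₘ pair (𝟙 Y) (𝟙 Y)) ≫ tensorμ X X Y Y := by
  simp only [pair, id_tensorHom_id, Category.comp_id]
  exact CopyDiscardCategory.copy_tensor X Y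

theorem pair_fst_snd (X Y : C) : pair (fst X Y) (snd X Y) = 𝟙 (X ⊗ Y) := by
  have braiding_unit : (β_ (𝟙_ C) (𝟙_ C)).hom = 𝟙 _ := by simp [unitors_inv_equal]
  calc pair (fst X Y) (snd X Y)
      = pair (𝟙 (X ⊗ Y)) (𝟙 (X ⊗ Y)) ≫ ((𝟙 X ⊗ₘ ε[Y]) ⊗ₘ (ε[X] ⊗ₘ 𝟙 Y)) ≫
          ((ρ_ X).hom ⊗ₘ (λ_ Y).hom) := by
        rw [tensorHom_comp_tensorHom, pair_comp_tensorHom, id_tensorHom, tensorHom_id, fst, snd,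
          Category.id_comp, Category.id_comp]
    _ = ((pair (𝟙 X) (𝟙 X) ≫ (𝟙 X ⊗ₘ ε[X])) ⊗ₘ (pair (𝟙 Y) (𝟙 Y) ≫ (ε[Y] ⊗ₘ 𝟙 Y))) ≫
          tensorμ X (𝟙_ C) (𝟙_ C) Y ≫ ((ρ_ X).hom ⊗ₘ (λ_ Y).hom) := by
        rw [pair_id_id_tensor, Category.assoc, ← tensorμ_natural_assoc,
          tensorHom_comp_tensorHom_assoc]
    _ = ((ρ_ X).inv ⊗ₘ (λ_ Y).inv) ≫ tensorμ X (𝟙_ C) (𝟙_ C) Y ≫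
          ((ρ_ X).hom ⊗ₘ (λ_ Y).hom) := by simp [pair]
    _ = 𝟙 (X ⊗ Y) := by
        rw [tensorμ, braiding_unit]
        monoidal

theorem pair_fst_comp_snd (f : X ⟶ Z) : pair (fst X Y ≫ f) (snd X Y) = f ▷ Y := by
  rw [← pair_comp_whiskerRight, pair_fst_snd, Category.id_comp]

/-- `p` is deterministic: copying its output amounts to applying it to two copies of its input.
This is phrased through `pair`, because for a tensor product `Deterministic` elaborates to the
comonoid structure of `Comon` instead of that of `CopyDiscardCategory`. -/
def IsDeterministic (p : X ⟶ Y) : Prop := p ≫ pair (𝟙 Y) (𝟙 Y) = pair p p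

namespace IsDeterministic

theorem comp_pair {p : W ⟶ X} (hp : IsDeterministic p) (f : X ⟶ Y) (g : X ⟶ Z) :
    p ≫ pair f g = pair (p ≫ f) (p ≫ g) := by
  rw [← pair_comp_tensorHom, ← hp, Category.assoc, pair_comp_tensorHom, Category.id_comp,
    Category.id_comp]

theorem id (X : C) : IsDeterministic (𝟙 X) := Category.id_comp _

theorem comp {p : W ⟶ X} {q : X ⟶ Y} (hp : IsDeterministic p) (hq : IsDeterministic q) :
    IsDeterministic (p ≫ q) := by
  rw [IsDeterministic, Category.assoc, hq, hp.comp_pair]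

theorem pair {f : X ⟶ Y} {g : X ⟶ Z} (hf : IsDeterministic f) (hg : IsDeterministic g) :
    IsDeterministic (pair f g) := by
  rw [IsDeterministic, pair_id_id_tensor, reassoc_of% pair_comp_tensorHom, hf, hg,
    pair_comp_tensorμ]

theorem discard (X : C) : IsDeterministic ε[X] := by
  have pair_id_unit : MarkovPairing.pair (𝟙 (𝟙_ C)) (𝟙 (𝟙_ C)) = (λ_ (𝟙_ C)).inv := by
    rw [MarkovPairing.pair, id_tensorHom_id, Category.comp_id]
    exact CopyDiscardCategory.copy_unit
  rw [IsDeterministic, pair_id_unit, MarkovPairing.pair]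
  simp [unitors_inv_equal]

theorem tensorHom {f : W ⟶ X} {g : Y ⟶ Z} (hf : IsDeterministic f) (hg : IsDeterministic g) :
    IsDeterministic (f ⊗ₘ g) := by
  calc (f ⊗ₘ g) ≫ MarkovPairing.pair (𝟙 (X ⊗ Z)) (𝟙 (X ⊗ Z))
      = (MarkovPairing.pair f f ⊗ₘ MarkovPairing.pair g g) ≫ tensorμ X X Z Z := by
        rw [pair_id_id_tensor, tensorHom_comp_tensorHom_assoc, hf, hg]
    _ = MarkovPairing.pair (𝟙 (W ⊗ Y)) (𝟙 (W ⊗ Y)) ≫ ((f ⊗ₘ g) ⊗ₘ (f ⊗ₘ g)) := by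
        rw [pair_id_id_tensor, Category.assoc, ← tensorμ_natural, tensorHom_comp_tensorHom_assoc,
          pair_comp_tensorHom, pair_comp_tensorHom, Category.id_comp, Category.id_comp]
    _ = MarkovPairing.pair (f ⊗ₘ g) (f ⊗ₘ g) := by
        rw [pair_comp_tensorHom, Category.id_comp]

theorem of_inv (e : X ≅ Y) (h : IsDeterministic e.inv) : IsDeterministic e.hom := by
  rw [IsDeterministic, ← cancel_epi e.inv, h.comp_pair, Iso.inv_hom_id,
    Iso.inv_hom_id_assoc]

theorem leftUnitor (X : C) : IsDeterministic (λ_ X).hom := by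
  have leftUnitor_inv : (λ_ X).inv = MarkovPairing.pair ε[X] (𝟙 X) := by
    simp [MarkovPairing.pair]
  exact .of_inv _ (leftUnitor_inv ▸ (discard X).pair (.id X))

theorem rightUnitor (X : C) : IsDeterministic (ρ_ X).hom := by
  have rightUnitor_inv : (ρ_ X).inv = MarkovPairing.pair (𝟙 X) ε[X] := by
    simp [MarkovPairing.pair]
  exact .of_inv _ (rightUnitor_inv ▸ (IsDeterministic.id X).pair (discard X))

theorem fst (X Y : C) : IsDeterministic (fst X Y) := by
  rw [MarkovPairing.fst, ← id_tensorHom]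
  exact ((IsDeterministic.id X).tensorHom (discard Y)).comp (rightUnitor X)

theorem snd (X Y : C) : IsDeterministic (snd X Y) := by
  rw [MarkovPairing.snd, ← tensorHom_id]
  exact ((discard X).tensorHom (.id Y)).comp (leftUnitor Y)

end IsDeterministic

end MarkovPairing

namespace FreeMarkov

open MarkovPairing

variable {V : Type u} {G : DAG V}

theorem nodes_tensorList (l : List V) : (tensorList G l).nodes = l := by
  induction l with
  | nil => rfl
  | cons v l ih => simp [tensorList, nodes, ih]

@[simp] theorem nodes_tensorObj (X Y : FreeMarkov G) : (X ⊗ Y).nodes = X.nodes ++ Y.nodes := rfl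

@[simp] theorem nodes_of (v : V) : (of v : FreeMarkov G).nodes = [v] := rfl

theorem nodes_tensorObj_subset {X Y : FreeMarkov G} {l : List V} :
    (X ⊗ Y).nodes ⊆ l ↔ X.nodes ⊆ l ∧ Y.nodes ⊆ l := List.append_subset

theorem nodes_of_subset {v : V} {l : List V} : (of v : FreeMarkov G).nodes ⊆ l ↔ v ∈ l := by
  simp

/-- The object of parents of a node, which is the domain of its generating box. -/
noncomputable abbrev paObj (G : DAG V) (a : V) : FreeMarkov G := tensorList G (G.pa a).toList

@[simp] theorem mem_nodes_paObj {v a : V} : v ∈ (paObj G a).nodes ↔ v ∈ G.pa a := by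
  simp [nodes_tensorList]

namespace Diagram

open Classical in
/-- The diagram that selects the leftmost occurrence of the node `v`. -/
noncomputable def pick (v : V) : (S : FreeMarkov G) → v ∈ S.nodes → Diagram G S (of v)
  | of _, h => (List.mem_singleton.1 h) ▸ id (of v)
  | unit, h => (List.not_mem_nil h).elim
  | tensor S T, h =>
    if hS : v ∈ S.nodes then ((discard T).whiskerLeft S).comp ((rightUnit S).comp (pick v S hS))
    else ((discard S).whiskerRight T).comp ((leftUnit T).comp
      (pick v T ((List.mem_append.1 h).resolve_left hS)))

/-- The diagram without boxes that selects the nodes occurring in `Y` among those of `S`. -/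
noncomputable def proj (S : FreeMarkov G) : (Y : FreeMarkov G) → Y.nodes ⊆ S.nodes → Diagram G S Y
  | of v, h => pick v S (nodes_of_subset.1 h)
  | unit, _ => discard S
  | tensor Y Z, h => (copy S).comp
      (((proj S Y (List.append_subset.1 h).1).whiskerRight S).comp
        ((proj S Z (List.append_subset.1 h).2).whiskerLeft Y))

@[simp] theorem boxes_pick {v : V} {S : FreeMarkov G} (h : v ∈ S.nodes) :
    (pick v S h).boxes = [] := by
  induction S with
  | of w => obtain rfl := List.mem_singleton.1 h; rfl
  | unit => exact (List.not_mem_nil h).elim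
  | tensor S T ihS ihT =>
    rw [pick]
    split <;> simp [boxes, ihS, ihT]

@[simp] theorem boxes_proj {S Y : FreeMarkov G} (h : Y.nodes ⊆ S.nodes) :
    (proj S Y h).boxes = [] := by
  induction Y with
  | of v => exact boxes_pick _
  | unit => rfl
  | tensor Y Z ihY ihZ => simp [proj, boxes, ihY, ihZ]

end Diagram

open Diagram

@[elab_as_elim] theorem induction_tensorObj {motive : FreeMarkov G → Prop}
    (of : ∀ v, motive (of v)) (unit : motive (𝟙_ (FreeMarkov G)))
    (tensor : ∀ X Y, motive X → motive Y → motive (X ⊗ Y)) (X : FreeMarkov G) : motive X := by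
  induction X with
  | of v => exact of v
  | unit => exact unit
  | tensor X Y ihX ihY => exact tensor X Y ihX ihY

section Select

variable {S T Y Z : FreeMarkov G}

/-- The morphism that selects the nodes occurring in `Y` among those of `S`. -/
noncomputable def select (S Y : FreeMarkov G) (h : Y.nodes ⊆ S.nodes) : S ⟶ Y := homMk (proj S Y h)

theorem select_tensor (h : (Y ⊗ Z).nodes ⊆ S.nodes) :
    select S (Y ⊗ Z) h = pair (select S Y (nodes_tensorObj_subset.1 h).1)
      (select S Z (nodes_tensorObj_subset.1 h).2) := rfl

theorem select_unit (h : (𝟙_ (FreeMarkov G)).nodes ⊆ S.nodes) : select S (𝟙_ _) h = ε[S] := rfl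

theorem select_of_of (v : V) (h : (of v : FreeMarkov G).nodes ⊆ (of v : FreeMarkov G).nodes) :
    select (of v) (of v) h = 𝟙 (of v) := rfl

theorem select_tensor_of_left {v : V} (h : (of v : FreeMarkov G).nodes ⊆ S.nodes)
    (hST : (of v : FreeMarkov G).nodes ⊆ (S ⊗ T).nodes) :
    select (S ⊗ T) (of v) hST = fst S T ≫ select S (of v) h := by
  refine Eq.trans ?_ (Category.assoc (S ◁ ε[T]) (ρ_ S).hom (select S (of v) h)).symm
  change homMk (pick v (tensor S T) _) = _
  rw [pick, dif_pos (nodes_of_subset.1 h)]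
  rfl

theorem select_tensor_of_right {v : V} (hS : v ∉ S.nodes)
    (h : (of v : FreeMarkov G).nodes ⊆ T.nodes)
    (hST : (of v : FreeMarkov G).nodes ⊆ (S ⊗ T).nodes) :
    select (S ⊗ T) (of v) hST = snd S T ≫ select T (of v) h := by
  refine Eq.trans ?_ (Category.assoc (ε[S] ▷ T) (λ_ T).hom (select T (of v) h)).symm
  change homMk (pick v (tensor S T) _) = _
  rw [pick, dif_neg hS]
  rfl

theorem isDeterministic_select_of (v : V) (h : (of v : FreeMarkov G).nodes ⊆ S.nodes) :
    IsDeterministic (select S (of v) h) := by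
  induction S using induction_tensorObj with
  | of w => obtain rfl := List.mem_singleton.1 (nodes_of_subset.1 h); exact .id _
  | unit => exact (List.not_mem_nil (nodes_of_subset.1 h)).elim
  | tensor S T ihS ihT =>
    by_cases hS : v ∈ S.nodes
    · rw [select_tensor_of_left (nodes_of_subset.2 hS)]
      exact (IsDeterministic.fst S T).comp (ihS _)
    · have hT : v ∈ T.nodes := (List.mem_append.1 (nodes_of_subset.1 h)).resolve_left hS
      rw [select_tensor_of_right hS (nodes_of_subset.2 hT)]
      exact (IsDeterministic.snd S T).comp (ihT _)

theorem isDeterministic_select (h : Y.nodes ⊆ S.nodes) : IsDeterministic (select S Y h) := by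
  induction Y using induction_tensorObj with
  | of v => exact isDeterministic_select_of v h
  | unit => exact .discard S
  | tensor Y Z ihY ihZ => exact (ihY _).pair (ihZ _)

theorem select_tensor_left (h : Y.nodes ⊆ S.nodes) (hST : Y.nodes ⊆ (S ⊗ T).nodes) :
    select (S ⊗ T) Y hST = fst S T ≫ select S Y h := by
  induction Y using induction_tensorObj with
  | of v => exact select_tensor_of_left h hST
  | unit => exact (MarkovCategory.discard_natural (fst S T)).symm
  | tensor Y Z ihY ihZ =>
    rw [select_tensor, select_tensor, (IsDeterministic.fst S T).comp_pair, ihY, ihZ]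

theorem select_tensor_right (h : Y.nodes ⊆ T.nodes) (hS : Y.nodes.Disjoint S.nodes)
    (hST : Y.nodes ⊆ (S ⊗ T).nodes) :
    select (S ⊗ T) Y hST = snd S T ≫ select T Y h := by
  induction Y using induction_tensorObj with
  | of v => exact select_tensor_of_right (List.singleton_disjoint.1 hS) h hST
  | unit => exact (MarkovCategory.discard_natural (snd S T)).symm
  | tensor Y Z ihY ihZ =>
    obtain ⟨hY, hZ⟩ := List.disjoint_append_left.1 hS
    rw [select_tensor, select_tensor, (IsDeterministic.snd S T).comp_pair, ihY _ hY, ihZ _ hZ]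

theorem select_comp_select_of {v : V} (hT : T.nodes ⊆ S.nodes)
    (h : (of v : FreeMarkov G).nodes ⊆ T.nodes) :
    select S T hT ≫ select T (of v) h = select S (of v) (List.Subset.trans h hT) := by
  induction T using induction_tensorObj with
  | of w =>
    obtain rfl := List.mem_singleton.1 (nodes_of_subset.1 h)
    exact Category.comp_id _
  | unit => exact (List.not_mem_nil (nodes_of_subset.1 h)).elim
  | tensor T T' ih ih' =>
    by_cases hv : v ∈ T.nodes
    · rw [select_tensor, select_tensor_of_left (nodes_of_subset.2 hv),
        reassoc_of% pair_comp_fst, ih]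
    · have hv' : v ∈ T'.nodes := (List.mem_append.1 (nodes_of_subset.1 h)).resolve_left hv
      rw [select_tensor, select_tensor_of_right hv (nodes_of_subset.2 hv'),
        reassoc_of% pair_comp_snd, ih']

theorem select_comp_select (hT : T.nodes ⊆ S.nodes) (hY : Y.nodes ⊆ T.nodes) :
    select S T hT ≫ select T Y hY = select S Y (List.Subset.trans hY hT) := by
  induction Y using induction_tensorObj with
  | of v => exact select_comp_select_of hT hY
  | unit => exact MarkovCategory.discard_natural _
  | tensor Y Z ihY ihZ =>
    rw [select_tensor, select_tensor, (isDeterministic_select hT).comp_pair, ihY, ihZ]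

theorem select_self (hS : S.nodes.Nodup) : select S S (List.Subset.refl _) = 𝟙 S := by
  induction S using induction_tensorObj with
  | of v => exact select_of_of v _
  | unit => exact Subsingleton.elim _ _
  | tensor S T ihS ihT =>
    obtain ⟨hS, hT, hdisj⟩ := List.nodup_append'.1 hS
    rw [select_tensor, select_tensor_left (List.Subset.refl _),
      select_tensor_right (List.Subset.refl _) hdisj.symm, ihS hS, ihT hT, Category.comp_id,
      Category.comp_id, pair_fst_snd]

end Select

/-- A morphism that only rearranges, copies or discards wires: precomposing it with a selection
gives a selection. -/
def IsStructural {X Y : FreeMarkov G} (f : X ⟶ Y) : Prop :=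
  ∀ (S : FreeMarkov G) (hX : X.nodes ⊆ S.nodes) (hY : Y.nodes ⊆ S.nodes),
    select S X hX ≫ f = select S Y hY

namespace IsStructural

variable (X Y Z : FreeMarkov G)

theorem id : IsStructural (𝟙 X) := fun _ _ _ => Category.comp_id _

theorem associator : IsStructural (α_ X Y Z).hom := fun _ _ _ => by
  simp only [select_tensor, pair_comp_associator]

theorem associator_inv : IsStructural (α_ X Y Z).inv := fun _ _ _ => by
  simp only [select_tensor, pair_comp_associator_inv]

theorem leftUnitor : IsStructural (λ_ X).hom := fun _ _ _ => by
  rw [select_tensor, select_unit, pair_discard_comp_leftUnitor]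

theorem leftUnitor_inv : IsStructural (λ_ X).inv := fun _ hX hY => by
  rw [Iso.comp_inv_eq, leftUnitor X _ hY hX]

theorem rightUnitor : IsStructural (ρ_ X).hom := fun _ _ _ => by
  rw [select_tensor, select_unit, pair_discard_comp_rightUnitor]

theorem rightUnitor_inv : IsStructural (ρ_ X).inv := fun _ hX hY => by
  rw [Iso.comp_inv_eq, rightUnitor X _ hY hX]

theorem braiding : IsStructural (β_ X Y).hom := fun _ _ _ => by
  simp only [select_tensor, pair_comp_braiding]

theorem copy : IsStructural Δ[X] := fun S hX _ => by
  have h := (isDeterministic_select hX).comp_pair (𝟙 X) (𝟙 X)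
  rwa [pair, id_tensorHom_id, Category.comp_id, Category.comp_id] at h

theorem discard : IsStructural ε[X] := fun _ _ _ => MarkovCategory.discard_natural _

end IsStructural

end FreeMarkov

namespace DAG

theorem exists_forall_not_adj {V : Type u} (G : DAG V) {s : Finset V} (hs : s.Nonempty) :
    ∃ a ∈ s, ∀ b ∈ s, ¬ G.Adj a b := by
  have : IsStrictOrder V fun x y => Relation.TransGen G.Adj y x :=
    { irrefl := G.acyclic, trans := fun _ _ _ hxy hyz => hyz.trans hxy }
  obtain ⟨⟨a, ha⟩, -, hmin⟩ := (s.finite_toSet.wellFoundedOn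
    (r := fun x y => Relation.TransGen G.Adj y x)).has_min Set.univ ⟨⟨_, hs.choose_spec⟩, trivial⟩
  exact ⟨a, ha, fun b hb hab => hmin ⟨b, hb⟩ trivial (.single hab)⟩

end DAG

namespace FreeMarkov

open MarkovPairing Diagram

variable {V : Type u} {G : DAG V}

/-- The generating morphism `pa(a) → a`. -/
noncomputable def gen (G : DAG V) (a : V) : paObj G a ⟶ of a := homMk (box a)

/-- `f` is a conditional of `B` given `A` in the joint distribution `σ` of the nodes of `S`, and `B`
is independent of `Y` given `A`. -/
def IsConditional {X S A B : FreeMarkov G} (σ : X ⟶ S) (f : A ⟶ B) (Y : FreeMarkov G) : Prop :=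
  ∀ (hA : (A ⊗ Y).nodes ⊆ S.nodes) (hB : (B ⊗ Y).nodes ⊆ S.nodes),
    σ ≫ select S (A ⊗ Y) hA ≫ f ▷ Y = σ ≫ select S (B ⊗ Y) hB

namespace IsConditional

variable {X S A B C Y Z : FreeMarkov G} {σ : X ⟶ S} {f : A ⟶ B} {g : B ⟶ C}

theorem of_isStructural (hf : IsStructural f) : IsConditional σ f Y := fun hA hB => by
  rw [select_tensor, select_tensor, pair_comp_whiskerRight,
    hf S _ (nodes_tensorObj_subset.1 hB).1]

theorem comp (hf : IsConditional σ f Y) (hg : IsConditional σ g Y) (hB : B.nodes ⊆ S.nodes) :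
    IsConditional σ (f ≫ g) Y := fun hA hC => by
  have hBY := nodes_tensorObj_subset.2 ⟨hB, (nodes_tensorObj_subset.1 hA).2⟩
  rw [comp_whiskerRight, ← hg hBY hC, ← reassoc_of% hf hA hBY]

theorem whiskerRight (hf : IsConditional σ f (Z ⊗ Y)) : IsConditional σ (f ▷ Z) Y :=
  fun hA hB => by
    have hA' : (A ⊗ Z ⊗ Y).nodes ⊆ S.nodes := by simpa using hA
    have hB' : (B ⊗ Z ⊗ Y).nodes ⊆ S.nodes := by simpa using hB
    rw [← IsStructural.associator_inv A Z Y S hA' hA,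
      ← IsStructural.associator_inv B Z Y S hB' hB, Category.assoc,
      ← associator_inv_naturality_left, reassoc_of% hf hA' hB']

theorem whiskerLeft (hf : IsConditional σ f (Z ⊗ Y)) : IsConditional σ (Z ◁ f) Y :=
  fun hA hB => by
    have eq_braiding : Z ◁ f = (β_ Z A).hom ≫ f ▷ Z ≫ (β_ B Z).hom := by simp
    rw [eq_braiding]
    simp only [nodes_tensorObj_subset] at hA hB
    refine (of_isStructural (IsStructural.braiding Z A)).comp
      (hf.whiskerRight.comp (of_isStructural (IsStructural.braiding B Z)) ?_) ?_ _ _ <;>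
    simp only [nodes_tensorObj_subset, hA, hB, and_self]

theorem of_subset (hf : IsConditional σ f Z) (hY : Y.nodes ⊆ Z.nodes) (hZ : Z.nodes ⊆ S.nodes) :
    IsConditional σ f Y := fun hA hB => by
  have select_factor : ∀ (D : FreeMarkov G) (hD : (D ⊗ Y).nodes ⊆ S.nodes)
      (hDZ : (D ⊗ Z).nodes ⊆ S.nodes),
      select S (D ⊗ Y) hD = select S (D ⊗ Z) hDZ ≫ D ◁ select Z Y hY := fun D hD hDZ => by
    rw [select_tensor, select_tensor, pair_comp_whiskerLeft, select_comp_select]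
  have hAZ := nodes_tensorObj_subset.2 ⟨(nodes_tensorObj_subset.1 hA).1, hZ⟩
  have hBZ := nodes_tensorObj_subset.2 ⟨(nodes_tensorObj_subset.1 hB).1, hZ⟩
  rw [select_factor A hA hAZ, select_factor B hB hBZ, ← reassoc_of% hf hAZ hBZ, Category.assoc,
    whisker_exchange]

theorem comp_select_comp (hf : IsConditional σ f (𝟙_ (FreeMarkov G))) (hA : A.nodes ⊆ S.nodes)
    (hB : B.nodes ⊆ S.nodes) : σ ≫ select S A hA ≫ f = σ ≫ select S B hB := by
  have hA' : (A ⊗ 𝟙_ (FreeMarkov G)).nodes ⊆ S.nodes :=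
    nodes_tensorObj_subset.2 ⟨hA, List.nil_subset _⟩
  have hB' : (B ⊗ 𝟙_ (FreeMarkov G)).nodes ⊆ S.nodes :=
    nodes_tensorObj_subset.2 ⟨hB, List.nil_subset _⟩
  rw [← IsStructural.rightUnitor A S hA' hA, ← IsStructural.rightUnitor B S hB' hB, Category.assoc,
    ← rightUnitor_naturality]
  exact (reassoc_of% hf hA' hB') _

end IsConditional

/-- The node set `P` is closed under parents, when the nodes of `X` are regarded as parentless. -/
structure IsAncestral (X : FreeMarkov G) (P : Set V) : Prop where
  subset : ∀ v ∈ X.nodes, v ∈ P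
  pa_subset : ∀ v ∈ P, v ∉ X.nodes → ∀ p ∈ G.pa v, p ∈ P

/-- `σ` is the joint distribution of the nodes of `S` given `X`: it extends the identity of `X`, and
satisfies the local Markov property that every node of `S` is generated by its box independently of
its non-descendants. -/
structure IsJoint {X S : FreeMarkov G} (σ : X ⟶ S) : Prop where
  isAncestral : IsAncestral X {v | v ∈ S.nodes}
  retract : σ ≫ select S X isAncestral.subset = select X X (List.Subset.refl _)
  isConditional_gen : ∀ P : Set V, IsAncestral X P → ∀ a ∈ S.nodes, a ∉ P →
    (∀ p ∈ G.pa a, p ∈ P) → ∀ Y : FreeMarkov G, (∀ v ∈ Y.nodes, v ∈ P) →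
      IsConditional σ (gen G a) Y

section Adjoin

variable {X S A B Y : FreeMarkov G}

theorem IsJoint.id (X : FreeMarkov G) : IsJoint (𝟙 X) where
  isAncestral := ⟨fun _ h => h, fun _ h hX => (hX h).elim⟩
  retract := Category.id_comp _
  isConditional_gen _ hP a ha haP := (haP (hP.subset a ha)).elim

/-- The joint distribution `σ` extended by the node `b`, which is generated from its parents. -/
noncomputable def adjoin (σ : X ⟶ S) (b : V) (hb : (paObj G b).nodes ⊆ S.nodes) : X ⟶ S ⊗ of b :=
  σ ≫ pair (𝟙 S) (select S (paObj G b) hb ≫ gen G b)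

variable {σ : X ⟶ S} {b : V} {hb : (paObj G b).nodes ⊆ S.nodes}

theorem adjoin_comp_select (hY : Y.nodes ⊆ S.nodes) (hY' : Y.nodes ⊆ (S ⊗ of b).nodes) :
    adjoin σ b hb ≫ select (S ⊗ of b) Y hY' = σ ≫ select S Y hY := by
  rw [adjoin, Category.assoc, select_tensor_left hY, reassoc_of% pair_comp_fst, Category.id_comp]

theorem adjoin_comp_select_tensor (hbS : b ∉ S.nodes) (hY : Y.nodes ⊆ S.nodes)
    (hYb : (Y ⊗ of b).nodes ⊆ (S ⊗ of b).nodes) :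
    adjoin σ b hb ≫ select (S ⊗ of b) (Y ⊗ of b) hYb =
      σ ≫ select S (Y ⊗ paObj G b) (nodes_tensorObj_subset.2 ⟨hY, hb⟩) ≫ Y ◁ gen G b := by
  have hdisj : (of b : FreeMarkov G).nodes.Disjoint S.nodes := List.singleton_disjoint.2 hbS
  have select_eq : select (S ⊗ of b) (Y ⊗ of b) hYb = select S Y hY ▷ of b := by
    rw [select_tensor, select_tensor_left hY,
      select_tensor_right (List.Subset.refl _) hdisj, select_of_of,
      Category.comp_id, pair_fst_comp_snd]
  rw [select_eq, adjoin, Category.assoc, pair_comp_whiskerRight, select_tensor,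
    pair_comp_whiskerLeft, Category.id_comp]

theorem IsConditional.adjoin {f : A ⟶ B} (hf : IsConditional σ f Y) (hA : A.nodes ⊆ S.nodes)
    (hB : B.nodes ⊆ S.nodes) (hY : Y.nodes ⊆ S.nodes) :
    IsConditional (adjoin σ b hb) f Y := fun hA' hB' => by
  have hAY := nodes_tensorObj_subset.2 ⟨hA, hY⟩
  have hBY := nodes_tensorObj_subset.2 ⟨hB, hY⟩
  rw [adjoin_comp_select hBY, ← hf hAY, reassoc_of% adjoin_comp_select hAY]

theorem IsConditional.adjoin_tensor {f : A ⟶ B} (hf : IsConditional σ f (Y ⊗ paObj G b))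
    (hbS : b ∉ S.nodes) (hA : A.nodes ⊆ S.nodes) (hB : B.nodes ⊆ S.nodes) (hY : Y.nodes ⊆ S.nodes) :
    IsConditional (FreeMarkov.adjoin σ b hb) f (Y ⊗ of b) := fun hA' hB' => by
  have adjoin_comp : ∀ (D : FreeMarkov G) (hD : D.nodes ⊆ S.nodes)
      (hD' : (D ⊗ Y ⊗ of b).nodes ⊆ (S ⊗ of b).nodes),
      FreeMarkov.adjoin σ b hb ≫ select (S ⊗ of b) (D ⊗ Y ⊗ of b) hD' =
        σ ≫ select S (D ⊗ Y ⊗ paObj G b)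
          (nodes_tensorObj_subset.2 ⟨hD, nodes_tensorObj_subset.2 ⟨hY, hb⟩⟩) ≫ D ◁ Y ◁ gen G b := by
    intro D hD hD'
    rw [← IsStructural.associator D Y (of b) _ (by simpa using hD'),
      reassoc_of% adjoin_comp_select_tensor hbS (nodes_tensorObj_subset.2 ⟨hD, hY⟩),
      associator_naturality_right,
      reassoc_of% IsStructural.associator D Y (paObj G b)]
  rw [reassoc_of% adjoin_comp A hA, adjoin_comp B hB, whisker_exchange, reassoc_of% hf]

theorem isConditional_adjoin_gen (hbS : b ∉ S.nodes) (hY : Y.nodes ⊆ S.nodes) :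
    IsConditional (adjoin σ b hb) (gen G b) Y := fun _ hB => by
  have hYb : (Y ⊗ of b).nodes ⊆ (S ⊗ of b).nodes :=
    nodes_tensorObj_subset.2 (nodes_tensorObj_subset.1 hB).symm
  rw [← IsStructural.braiding Y (of b) _ hYb, reassoc_of% adjoin_comp_select_tensor hbS hY,
    BraidedCategory.braiding_naturality_right,
    reassoc_of% IsStructural.braiding Y (paObj G b) S _ (nodes_tensorObj_subset.2 ⟨hb, hY⟩),
    reassoc_of% adjoin_comp_select (nodes_tensorObj_subset.2 ⟨hb, hY⟩)]

open Classical in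
theorem IsJoint.isConditional_adjoin_gen (hσ : IsJoint σ) (hbS : b ∉ S.nodes) {P : Set V}
    (hP : IsAncestral X P) {a : V} (ha : a ∈ S.nodes) (haP : a ∉ P) (hpa : ∀ p ∈ G.pa a, p ∈ P)
    (hY : ∀ v ∈ Y.nodes, v ∈ P) : IsConditional (adjoin σ b hb) (gen G a) Y := fun hA hB => by
  have hpaS : (paObj G a).nodes ⊆ S.nodes := fun p hp =>
    hσ.isAncestral.pa_subset a ha (fun haX => haP (hP.subset a haX)) p (mem_nodes_paObj.1 hp)
  have haS : (of a : FreeMarkov G).nodes ⊆ S.nodes := nodes_of_subset.2 ha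
  have hYSb : Y.nodes ⊆ S.nodes ++ [b] := (nodes_tensorObj_subset.1 hA).2
  by_cases hbP : b ∈ P
  · -- The node `b` may occur anywhere in `Y`, also repeatedly; `Y₀ ⊗ b` separates it off.
    let Y₀ : FreeMarkov G := tensorList G (Y.nodes.filter (· ≠ b))
    have mem_Y₀ : ∀ {v}, v ∈ Y₀.nodes ↔ v ∈ Y.nodes ∧ v ≠ b := by simp [Y₀, nodes_tensorList]
    have hY₀ : Y₀.nodes ⊆ S.nodes := fun v hv => by
      simpa [(mem_Y₀.1 hv).2] using hYSb (mem_Y₀.1 hv).1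
    have hYY₀ : Y.nodes ⊆ (Y₀ ⊗ of b).nodes := fun v hv => by
      by_cases hvb : v = b <;> simp [mem_Y₀, hv, hvb]
    have hYP : ∀ v ∈ (Y₀ ⊗ paObj G b).nodes, v ∈ P := fun v hv => by
      rcases List.mem_append.1 hv with hv | hv
      · exact hY v (mem_Y₀.1 hv).1
      · exact hP.pa_subset b hbP (fun hbX => hbS (hσ.isAncestral.subset b hbX)) v
          (mem_nodes_paObj.1 hv)
    have hcond := (hσ.isConditional_gen P hP a ha haP hpa _ hYP).adjoin_tensor (hb := hb) hbS hpaS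
      haS hY₀
    have hY₀b : (Y₀ ⊗ of b).nodes ⊆ (S ⊗ of b).nodes := nodes_tensorObj_subset.2
      ⟨fun v hv => List.mem_append_left _ (hY₀ hv), List.subset_append_right _ _⟩
    exact hcond.of_subset hYY₀ hY₀b hA hB
  · have hYS : Y.nodes ⊆ S.nodes := fun v hv => by
      have hvb : v ≠ b := fun h => hbP (h ▸ hY v hv)
      simpa [hvb] using hYSb hv
    exact (hσ.isConditional_gen P hP a ha haP hpa Y hY).adjoin hpaS haS hYS hA hB

theorem IsJoint.adjoin (hσ : IsJoint σ) (hbS : b ∉ S.nodes) : IsJoint (adjoin σ b hb) where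
  isAncestral :=
    { subset := fun v hv => List.mem_append_left _ (hσ.isAncestral.subset v hv)
      pa_subset := fun v hv hvX p hp => by
        rcases List.mem_append.1 hv with hv | hv
        · exact List.mem_append_left _ (hσ.isAncestral.pa_subset v hv hvX p hp)
        · obtain rfl := List.mem_singleton.1 hv
          exact List.mem_append_left _ (hb (mem_nodes_paObj.2 hp)) }
  retract := (adjoin_comp_select hσ.isAncestral.subset _).trans hσ.retract
  isConditional_gen P hP a ha haP hpa Y hY := by
    rcases List.mem_append.1 ha with ha | ha
    · exact hσ.isConditional_adjoin_gen hbS hP ha haP hpa hY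
    · obtain rfl := List.mem_singleton.1 ha
      intro hA hB
      refine FreeMarkov.isConditional_adjoin_gen hbS (fun v hv => ?_) hA hB
      have hva : v ≠ a := fun h => haP (h ▸ hY v hv)
      simpa [hva] using hA (List.mem_append_right _ hv)

end Adjoin

open Classical in
theorem exists_isJoint (X : FreeMarkov G) (s : Finset V) (hX : ∀ a ∈ s, a ∉ X.nodes)
    (hpa : ∀ a ∈ s, ∀ p ∈ G.pa a, p ∈ X.nodes ∨ p ∈ s) :
    ∃ (S : FreeMarkov G) (d : Diagram G X S), IsJoint (homMk d) ∧
      (∀ v, v ∈ S.nodes ↔ v ∈ X.nodes ∨ v ∈ s) ∧ (d.boxes : Multiset V) = s.val := by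
  induction s using Finset.strongInduction with
  | H s ih =>
    rcases s.eq_empty_or_nonempty with rfl | hs
    · exact ⟨X, .id X, .id X, by simp, rfl⟩
    obtain ⟨b, hbs, hsink⟩ := G.exists_forall_not_adj hs
    obtain ⟨S, d, hd, hS, hboxes⟩ := ih (s.erase b) (Finset.erase_ssubset hbs)
      (fun a ha => hX a (Finset.mem_of_mem_erase ha))
      (fun a ha p hp => (hpa a (Finset.mem_of_mem_erase ha) p hp).imp_right fun hps =>
        Finset.mem_erase.2
          ⟨by rintro rfl; exact hsink a (Finset.mem_of_mem_erase ha) hp, hps⟩)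
    have hbS : b ∉ S.nodes := by simp [hS, hX b hbs]
    have hpaS : (paObj G b).nodes ⊆ S.nodes := fun p hp => (hS p).2 <|
      (hpa b hbs p (mem_nodes_paObj.1 hp)).imp_right fun hps =>
        Finset.mem_erase.2 ⟨by rintro rfl; exact hsink p hbs (mem_nodes_paObj.1 hp), hps⟩
    refine ⟨S ⊗ of b, d.comp ((copy S).comp (((Diagram.id S).whiskerRight S).comp
      (((proj S (paObj G b) hpaS).comp (box b)).whiskerLeft S))), hd.adjoin (hb := hpaS) hbS,
      fun v => ?_, ?_⟩
    · by_cases hv : v = b <;> simp [hS, hv, hbs]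
    · simp only [boxes, boxes_proj, List.nil_append, ← Multiset.coe_add, hboxes]
      rw [Finset.erase_val, Multiset.coe_singleton, add_comm, Multiset.singleton_add,
        Multiset.cons_erase hbs]

section Uniqueness

variable {X Y A B S : FreeMarkov G}

theorem mem_nodes_or_mem_boxes (d : Diagram G A B) {v : V} (hv : v ∈ B.nodes) :
    v ∈ A.nodes ∨ v ∈ d.boxes := by
  induction d <;> simp_all [nodes, boxes] <;> grind

theorem mem_nodes_or_mem_boxes_of_mem_pa (d : Diagram G A B) {a p : V} (ha : a ∈ d.boxes)
    (hp : p ∈ G.pa a) : p ∈ A.nodes ∨ p ∈ d.boxes := by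
  induction d with
  | box b => obtain rfl := List.mem_singleton.1 ha; exact .inl (mem_nodes_paObj.2 hp)
  | comp f g ihf ihg =>
    rcases List.mem_append.1 ha with ha | ha
    · exact (ihf ha).imp_right (List.mem_append_left _)
    · rcases ihg ha with hp | hp
      · exact (mem_nodes_or_mem_boxes f hp).imp_right (List.mem_append_left _)
      · exact .inr (List.mem_append_right _ hp)
  | whiskerLeft X f ih => exact (ih ha).imp_left (List.mem_append_right _)
  | whiskerRight f Z ih => exact (ih ha).imp_left (List.mem_append_left _)
  | _ => exact (List.not_mem_nil ha).elim

theorem IsAncestral.union_boxes {P : Set V} (hP : IsAncestral X P) (d : Diagram G A B)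
    (hA : ∀ v ∈ A.nodes, v ∈ P) : IsAncestral X (P ∪ {v | v ∈ d.boxes}) where
  subset v hv := .inl (hP.subset v hv)
  pa_subset v hv hvX p hp := hv.elim (fun hv => .inl (hP.pa_subset v hv hvX p hp)) fun hv =>
    (mem_nodes_or_mem_boxes_of_mem_pa d hv hp).imp_left (hA p)

theorem IsJoint.isConditional_homMk {σ : X ⟶ S} (hσ : IsJoint σ) (d : Diagram G A B)
    (hd : d.boxes.Nodup) (hdS : d.boxes ⊆ S.nodes) {P : Set V} (hP : IsAncestral X P)
    (hdP : ∀ v ∈ d.boxes, v ∉ P) (hA : ∀ v ∈ A.nodes, v ∈ P) (hY : ∀ v ∈ Y.nodes, v ∈ P) :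
    IsConditional σ (homMk d) Y := by
  induction d generalizing P Y with
  | box a =>
    exact hσ.isConditional_gen P hP a (hdS (List.mem_singleton_self a))
      (hdP a (List.mem_singleton_self a)) (fun p hp => hA p (mem_nodes_paObj.2 hp)) Y hY
  | comp f g ihf ihg =>
    obtain ⟨hf, hg, hfg⟩ := List.nodup_append'.1 hd
    obtain ⟨hfS, hgS⟩ := List.append_subset.1 hdS
    have hmid := fun v (hv : v ∈ _) => mem_nodes_or_mem_boxes f (v := v) hv
    intro hA' hB'
    refine (ihf hf hfS hP (fun v hv => hdP v (List.mem_append_left _ hv)) hA hY).comp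
      (ihg hg hgS (hP.union_boxes f hA) ?_ (fun v hv => (hmid v hv).imp_left (hA v))
        fun v hv => .inl (hY v hv)) ?_ hA' hB'
    · exact fun v hv => not_or.2 ⟨hdP v (List.mem_append_right _ hv), fun hvf => hfg hvf hv⟩
    · exact fun v hv => (hmid v hv).elim (fun hvA => (nodes_tensorObj_subset.1 hA').1 hvA) (@hfS v)
  | whiskerLeft Z f ih =>
    have hZY : ∀ v ∈ (Z ⊗ Y).nodes, v ∈ P := fun v hv =>
      (List.mem_append.1 hv).elim (fun hvZ => hA v (List.mem_append_left _ hvZ)) (hY v)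
    exact (ih hd hdS hP hdP (fun v hv => hA v (List.mem_append_right _ hv)) hZY).whiskerLeft
  | whiskerRight f Z ih =>
    have hZY : ∀ v ∈ (Z ⊗ Y).nodes, v ∈ P := fun v hv =>
      (List.mem_append.1 hv).elim (fun hvZ => hA v (List.mem_append_right _ hvZ)) (hY v)
    exact (ih hd hdS hP hdP (fun v hv => hA v (List.mem_append_left _ hv)) hZY).whiskerRight
  | id => exact .of_isStructural (.id _)
  | assoc => exact .of_isStructural (.associator _ _ _)
  | assocInv => exact .of_isStructural (.associator_inv _ _ _)
  | leftUnit => exact .of_isStructural (.leftUnitor _)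
  | leftUnitInv => exact .of_isStructural (.leftUnitor_inv _)
  | rightUnit => exact .of_isStructural (.rightUnitor _)
  | rightUnitInv => exact .of_isStructural (.rightUnitor_inv _)
  | swap => exact .of_isStructural (.braiding _ _)
  | copy => exact .of_isStructural (.copy _)
  | discard => exact .of_isStructural (.discard _)

theorem IsJoint.comp_select_eq_homMk {σ : X ⟶ S} (hσ : IsJoint σ) (d : Diagram G X Y)
    (hd : (X.nodes ++ d.boxes).Nodup) (hdS : d.boxes ⊆ S.nodes) (hY : Y.nodes ⊆ S.nodes) :
    σ ≫ select S Y hY = homMk d := by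
  obtain ⟨hX, hboxes, hdisj⟩ := List.nodup_append'.1 hd
  have hcond : IsConditional σ (homMk d) (𝟙_ (FreeMarkov G)) :=
    hσ.isConditional_homMk d hboxes hdS (P := {v | v ∈ X.nodes})
      ⟨fun _ h => h, fun _ h hX => (hX h).elim⟩
      (fun v hv hvX => hdisj hvX hv) (fun _ h => h) fun _ h => (List.not_mem_nil h).elim
  rw [← hcond.comp_select_comp hσ.isAncestral.subset hY, ← Category.assoc, hσ.retract,
    select_self hX, Category.id_comp]

open Classical in
theorem IsInterventional.unique {f g : X ⟶ Y} (hf : IsInterventional f) (hg : IsInterventional g) :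
    f = g := by
  obtain ⟨d, rfl, hd⟩ := hf
  obtain ⟨e, rfl, he⟩ := hg
  obtain ⟨S, σ, hσ, hS, -⟩ := exists_isJoint X (d.boxes ++ e.boxes).toFinset
    (fun a ha haX => by
      rcases List.mem_append.1 (List.mem_toFinset.1 ha) with ha | ha
      · exact (List.nodup_append'.1 hd).2.2 haX ha
      · exact (List.nodup_append'.1 he).2.2 haX ha)
    (fun a ha p hp => by
      simp only [List.mem_toFinset, List.mem_append] at ha ⊢
      rcases ha with ha | ha
      · exact (mem_nodes_or_mem_boxes_of_mem_pa d ha hp).imp_right .inl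
      · exact (mem_nodes_or_mem_boxes_of_mem_pa e ha hp).imp_right .inr)
  have hdS : d.boxes ⊆ S.nodes := fun v hv => by simp [hS, hv]
  have heS : e.boxes ⊆ S.nodes := fun v hv => by simp [hS, hv]
  have hYS : Y.nodes ⊆ S.nodes := fun v hv =>
    (mem_nodes_or_mem_boxes d hv).elim (hσ.isAncestral.subset v) (@hdS v)
  rw [← hσ.comp_select_eq_homMk d hd hdS hYS, hσ.comp_select_eq_homMk e he heS hYS]

end Uniqueness

end FreeMarkov

namespace FreeMarkov

open Diagram

variable {V W : Type u} {G : DAG V} {H : DAG W}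

/-- The object obtained by replacing every node `w` by the object `T w`. -/
def substObj (T : W → FreeMarkov G) : FreeMarkov H → FreeMarkov G
  | of w => T w
  | unit => unit
  | tensor X Y => tensor (substObj T X) (substObj T Y)

variable (T : W → FreeMarkov G) (B : ∀ w, Diagram G (substObj T (paObj H w)) (T w))

/-- The diagram obtained by replacing every box `pa(w) → w` by the diagram `B w`. -/
def Diagram.subst : {X Y : FreeMarkov H} → Diagram H X Y →
    Diagram G (substObj T X) (substObj T Y)
  | _, _, .box w => B w
  | _, _, .id _ => .id _
  | _, _, .comp f g => (f.subst).comp g.subst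
  | _, _, .whiskerLeft X f => f.subst.whiskerLeft (substObj T X)
  | _, _, .whiskerRight f X => f.subst.whiskerRight (substObj T X)
  | _, _, .assoc _ _ _ => .assoc _ _ _
  | _, _, .assocInv _ _ _ => .assocInv _ _ _
  | _, _, .leftUnit _ => .leftUnit _
  | _, _, .leftUnitInv _ => .leftUnitInv _
  | _, _, .rightUnit _ => .rightUnit _
  | _, _, .rightUnitInv _ => .rightUnitInv _
  | _, _, .swap _ _ => .swap _ _
  | _, _, .copy _ => .copy _
  | _, _, .discard _ => .discard _

theorem Diagram.Rel.subst {X Y : FreeMarkov H} {f g : Diagram H X Y} (h : Rel f g) :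
    Rel (f.subst T B) (g.subst T B) := by
  induction h with
  | symm _ ih => exact ih.symm
  | trans _ _ ih ih' => exact ih.trans ih'
  | comp _ _ ih ih' => exact ih.comp ih'
  | whiskerLeft X _ ih => exact ih.whiskerLeft _
  | whiskerRight X _ ih => exact ih.whiskerRight _
  | refl => exact .refl ..
  | id_comp => exact .id_comp ..
  | comp_id => exact .comp_id ..
  | comp_assoc => exact .comp_assoc ..
  | whiskerLeft_id => exact .whiskerLeft_id ..
  | id_whiskerRight => exact .id_whiskerRight ..
  | whiskerLeft_comp => exact .whiskerLeft_comp ..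
  | comp_whiskerRight => exact .comp_whiskerRight ..
  | exchange => exact .exchange ..
  | assoc_hom_inv => exact .assoc_hom_inv ..
  | assoc_inv_hom => exact .assoc_inv_hom ..
  | leftUnit_hom_inv => exact .leftUnit_hom_inv ..
  | leftUnit_inv_hom => exact .leftUnit_inv_hom ..
  | rightUnit_hom_inv => exact .rightUnit_hom_inv ..
  | rightUnit_inv_hom => exact .rightUnit_inv_hom ..
  | assoc_nat_left => exact .assoc_nat_left ..
  | assoc_nat_middle => exact .assoc_nat_middle ..
  | assoc_nat_right => exact .assoc_nat_right ..
  | leftUnit_nat => exact .leftUnit_nat ..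
  | rightUnit_nat => exact .rightUnit_nat ..
  | pentagon => exact .pentagon ..
  | triangle => exact .triangle ..
  | swap_swap => exact .swap_swap ..
  | swap_nat_right => exact .swap_nat_right ..
  | swap_nat_left => exact .swap_nat_left ..
  | hexagon_forward => exact .hexagon_forward ..
  | hexagon_reverse => exact .hexagon_reverse ..
  | copy_discard_left => exact .copy_discard_left ..
  | copy_discard_right => exact .copy_discard_right ..
  | copy_assoc => exact .copy_assoc ..
  | copy_swap => exact .copy_swap ..
  | copy_tensor => exact .copy_tensor ..
  | discard_tensor => exact .discard_tensor ..
  | copy_unit => exact .copy_unit ..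
  | discard_unit => exact .discard_unit ..
  | discard_nat => exact .discard_nat ..

/-- The functor that replaces every node `w` by the object `T w` and every box `pa(w) → w` by the
diagram `B w`. -/
def substFunctor : FreeMarkov H ⥤ FreeMarkov G where
  obj := substObj T
  map := Quotient.map (subst T B) fun _ _ => Rel.subst T B
  map_id _ := rfl
  map_comp := by rintro X Y Z ⟨f⟩ ⟨g⟩; rfl

/-- The strict monoidal structure of `substFunctor`. -/
def substCoreMonoidal : (substFunctor T B).CoreMonoidal where
  εIso := Iso.refl _
  μIso _ _ := Iso.refl _
  μIso_hom_natural_left := by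
    rintro X Y ⟨f⟩ Z
    exact (Category.comp_id _).trans (Category.id_comp _).symm
  μIso_hom_natural_right := by
    rintro X Y Z ⟨f⟩
    exact (Category.comp_id _).trans (Category.id_comp _).symm
  associativity X Y Z := by
    change 𝟙 (substObj T X ⊗ substObj T Y) ▷ substObj T Z ≫ 𝟙 _ ≫ (α_ _ _ _).hom =
      (α_ _ _ _).hom ≫ substObj T X ◁ 𝟙 (substObj T Y ⊗ substObj T Z) ≫ 𝟙 _
    rw [id_whiskerRight, MonoidalCategory.whiskerLeft_id, Category.id_comp, Category.id_comp,
      Category.comp_id, Category.comp_id]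
  left_unitality X := by
    change (λ_ (substObj T X)).hom =
      𝟙 (𝟙_ (FreeMarkov G)) ▷ substObj T X ≫ 𝟙 _ ≫ (λ_ (substObj T X)).hom
    rw [id_whiskerRight, Category.id_comp, Category.id_comp]
  right_unitality X := by
    change (ρ_ (substObj T X)).hom =
      substObj T X ◁ 𝟙 (𝟙_ (FreeMarkov G)) ≫ 𝟙 _ ≫ (ρ_ (substObj T X)).hom
    rw [MonoidalCategory.whiskerLeft_id, Category.id_comp, Category.id_comp]

instance : (substFunctor T B).Braided where
  toMonoidal := (substCoreMonoidal T B).toMonoidal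
  braided X Y :=
    (Category.id_comp (β_ (substObj T X) (substObj T Y)).hom).trans (Category.comp_id _).symm

/-- `substFunctor` as a Markov functor. -/
def substMarkov : MarkovFunctor (FreeMarkov H) (FreeMarkov G) where
  toFunctor := substFunctor T B
  obj_unit := rfl
  obj_tensor _ _ := rfl
  unit_eq := rfl
  tensor_eq _ _ := rfl
  map_copy _ := (Category.comp_id _).symm
  map_discard _ := (Category.comp_id _).symm

variable {T}

theorem nodes_substObj (X : FreeMarkov H) :
    (substObj T X).nodes = X.nodes.flatMap fun w => (T w).nodes := by
  induction X with
  | of w => simp [substObj, nodes]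
  | unit => rfl
  | tensor X Y ihX ihY => simp [substObj, nodes, ihX, ihY]

variable {B}

theorem boxes_subst {X Y : FreeMarkov H} (d : Diagram H X Y) :
    (d.subst T B).boxes = d.boxes.flatMap fun w => (B w).boxes := by
  induction d with
  | box w => exact (List.append_nil _).symm
  | comp f g ihf ihg => simp [subst, boxes, ihf, ihg]
  | whiskerLeft _ _ ih => exact ih
  | whiskerRight _ _ ih => exact ih
  | _ => rfl

theorem substObj_injective (hT : Function.Injective T) (h : ∀ w, ∃ v Z, T w = tensor (of v) Z) :
    Function.Injective (substObj (H := H) T) := by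
  choose v Z h using h
  have ne_of : ∀ (X : FreeMarkov H) v, substObj T X ≠ of v := by
    intro X v
    cases X <;> simp [substObj, h]
  intro X Y hXY
  induction X generalizing Y with
  | of w =>
    cases Y with
    | of w' => exact congrArg of (hT hXY)
    | unit => simp [substObj, h] at hXY
    | tensor Y Y' => simp [substObj, h, (ne_of Y _).symm] at hXY
  | unit => cases Y <;> simp_all [substObj]
  | tensor X X' ih ih' =>
    cases Y with
    | of w => simp [substObj, h, ne_of X] at hXY
    | unit => simp [substObj] at hXY
    | tensor Y Y' =>
      simp only [substObj, tensor.injEq] at hXY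
      rw [ih hXY.1, ih' hXY.2]

theorem embedsRestr_substMarkov (hT : ∀ w, ∃ v Z, T w = tensor (of v) Z) {terr : W → Set V}
    (hterr : Pairwise (Function.onFun Disjoint terr))
    (hTn : ∀ w, (T w).nodes.Nodup) (hTt : ∀ w, ∀ v ∈ (T w).nodes, v ∈ terr w)
    (hBn : ∀ w, (B w).boxes.Nodup) (hBt : ∀ w, ∀ v ∈ (B w).boxes, v ∈ terr w) :
    (substMarkov T B).EmbedsRestr := by
  have nodup_flatMap : ∀ (f : W → List V) (l : List W), (∀ w, (f w).Nodup) →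
      (∀ w, ∀ v ∈ f w, v ∈ terr w) → l.Nodup → (l.flatMap f).Nodup := fun f l hf hft hl =>
    List.nodup_flatMap.2 ⟨fun w _ => hf w, hl.imp fun hw v hv hv' =>
      Set.disjoint_left.1 (hterr hw) (hft _ v hv) (hft _ v hv')⟩
  refine ⟨substObj_injective (fun w w' hw => ?_) hT, ?_, ?_, fun f g hf hg _ => hf.unique hg⟩
  · obtain ⟨v, Z, hv⟩ := hT w
    have hvT : v ∈ (T w).nodes := by rw [hv]; exact List.mem_cons_self
    exact hterr.eq (Set.not_disjoint_iff.2 ⟨v, hTt w v hvT, hTt w' v (hw ▸ hvT)⟩)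
  · rintro X Y f ⟨d, rfl, hd⟩
    exact ⟨d.subst T B, rfl, boxes_subst (B := B) d ▸ nodup_flatMap _ _ hBn hBt hd⟩
  · rintro X Y f ⟨d, rfl, hd⟩
    refine ⟨d.subst T B, rfl, ?_⟩
    obtain ⟨hX, hd, hXd⟩ := List.nodup_append'.1 hd
    change ((substObj T X).nodes ++ (d.subst T B).boxes).Nodup
    rw [nodes_substObj, boxes_subst]
    refine List.nodup_append'.2
      ⟨nodup_flatMap _ _ hTn hTt hX, nodup_flatMap _ _ hBn hBt hd, fun v hv hv' => ?_⟩
    obtain ⟨w, hw, hv⟩ := List.mem_flatMap.1 hv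
    obtain ⟨w', hw', hv'⟩ := List.mem_flatMap.1 hv'
    have hww' : w ≠ w' := fun h => hXd hw (h ▸ hw')
    exact Set.disjoint_left.1 (hterr hww') (hTt w v hv) (hBt w' v hv')

theorem exists_diagram_boxes_eq {X Y : FreeMarkov G} {s : Finset V} (hX : ∀ a ∈ s, a ∉ X.nodes)
    (hpa : ∀ a ∈ s, ∀ p ∈ G.pa a, p ∈ X.nodes ∨ p ∈ s)
    (hY : ∀ v ∈ Y.nodes, v ∈ X.nodes ∨ v ∈ s) :
    ∃ d : Diagram G X Y, (d.boxes : Multiset V) = s.val := by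
  obtain ⟨S, d, -, hS, hd⟩ := exists_isJoint X s hX hpa
  have hYS : Y.nodes ⊆ S.nodes := fun v hv => (hS v).2 (hY v hv)
  exact ⟨d.comp (proj S Y hYS), by rw [boxes, boxes_proj, List.append_nil, hd]⟩

end FreeMarkov

namespace DAG

variable {V W : Type u} {G : DAG V} {H : DAG W} {cl terr : W → Set V}

/-- The nodes of `H` come from clusters of nodes of `G`, and around its cluster every node `w` has a
territory, disjoint from the other ones, whose nodes are generated by the box of `w`. Hence the
territory contains the parents of its nodes unless they belong to clusters, and the latter are the
clusters of the parents of `w`. -/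
structure HasTerritories (G : DAG V) (H : DAG W) (cl terr : W → Set V) : Prop where
  nonempty : ∀ w, (cl w).Nonempty
  finite : ∀ w, (terr w).Finite
  subset : ∀ w, cl w ⊆ terr w
  disjoint : Pairwise (Function.onFun Disjoint terr)
  mem_of_adj : ∀ {w a p}, a ∈ terr w → G.Adj p a → p ∈ terr w ∨ ∃ w', p ∈ cl w'
  adj_iff : ∀ {w w'}, w ≠ w' → (H.Adj w w' ↔ ∃ p ∈ cl w, ∃ a ∈ terr w', G.Adj p a)

theorem ne_of_adj (H : DAG W) {w w' : W} (h : H.Adj w w') : w ≠ w' := by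
  rintro rfl
  exact H.acyclic w (.single h)

open FreeMarkov

theorem HasTerritories.exists_diagram (h : G.HasTerritories H cl terr) {T : W → FreeMarkov G}
    (hT : ∀ w v, v ∈ (T w).nodes ↔ v ∈ cl w) (w : W) :
    ∃ d : Diagram G (substObj T (paObj H w)) (T w),
      (d.boxes : Multiset V) = (h.finite w).toFinset.val := by
  have mem_dom : ∀ v, v ∈ (substObj T (paObj H w)).nodes ↔ ∃ w', H.Adj w' w ∧ v ∈ cl w' :=
    fun v => by simp [nodes_substObj, hT, DAG.Adj]
  refine exists_diagram_boxes_eq (fun a ha haX => ?_) (fun a ha p hp => ?_) fun v hv => ?_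
  · obtain ⟨w', hw', haw'⟩ := (mem_dom a).1 haX
    exact Set.disjoint_left.1 (h.disjoint (H.ne_of_adj hw')) (h.subset w' haw')
      ((h.finite w).mem_toFinset.1 ha)
  · rw [mem_dom, (h.finite w).mem_toFinset, or_comm]
    have ha' := (h.finite w).mem_toFinset.1 ha
    refine (h.mem_of_adj ha' hp).elim .inl fun ⟨w', hw'⟩ => ?_
    rcases eq_or_ne w' w with rfl | hne
    · exact .inl (h.subset _ hw')
    · exact .inr ⟨w', (h.adj_iff hne).2 ⟨p, hw', a, ha', hp⟩, hw'⟩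
  · exact .inr ((h.finite w).mem_toFinset.2 (h.subset w ((hT w v).1 hv)))

theorem HasTerritories.exists_markovFunctor (h : G.HasTerritories H cl terr) :
    ∃ ι : MarkovFunctor (FreeMarkov H) (FreeMarkov G), ι.EmbedsRestr ∧
      ∀ w, {v | v ∈ (ι.toFunctor.obj (of w)).nodes} = cl w := by
  have hfin : ∀ w, (cl w).Finite := fun w => (h.finite w).subset (h.subset w)
  let T : W → FreeMarkov G := fun w => tensorList G (hfin w).toFinset.toList
  have mem_T : ∀ w v, v ∈ (T w).nodes ↔ v ∈ cl w := by simp [T, nodes_tensorList]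
  have nodup_T : ∀ w, (T w).nodes.Nodup := fun w => by
    rw [nodes_tensorList]
    exact Finset.nodup_toList _
  have T_eq_tensor : ∀ w, ∃ v Z, T w = tensor (of v) Z := fun w => by
    have hne : (hfin w).toFinset.toList ≠ [] := by simpa using (h.nonempty w).ne_empty
    obtain ⟨v, l, hl⟩ := List.exists_cons_of_ne_nil hne
    exact ⟨v, tensorList G l, congrArg (tensorList G) hl⟩
  choose B hB using h.exists_diagram mem_T
  refine ⟨substMarkov T B, embedsRestr_substMarkov T_eq_tensor h.disjoint nodup_T
    (fun w v hv => h.subset w ((mem_T w v).1 hv)) (fun w => ?_) (fun w v hv => ?_),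
    fun w => Set.ext (mem_T w)⟩
  · rw [← Multiset.coe_nodup, hB]
    exact (h.finite w).toFinset.nodup
  · rwa [← Multiset.mem_coe, hB, Finset.mem_val, (h.finite w).mem_toFinset] at hv

end DAG

namespace DAG

variable {V W W' : Type u} {G : DAG V} {H : DAG W} {H' : DAG W'} {cl terr : W → Set V}

namespace HasTerritories

theorem eq_of_mem (h : G.HasTerritories H cl terr) {w w' : W} {v : V} (hv : v ∈ terr w)
    (hv' : v ∈ terr w') : w = w' :=
  h.disjoint.eq (Set.not_disjoint_iff.2 ⟨v, hv, hv'⟩)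

theorem exists_adj_of_common_parent (h : G.HasTerritories H cl terr) {w w' : W} (hne : w ≠ w')
    {p a a' : V} (ha : a ∈ terr w) (ha' : a' ∈ terr w') (hpa : G.Adj p a) (hpa' : G.Adj p a')
    (hp : p ∉ cl w) (hp' : p ∉ cl w') : ∃ q, p ∈ cl q ∧ H.Adj q w ∧ H.Adj q w' := by
  have adj_of_mem : ∀ {q x b}, p ∈ cl q → p ∉ cl x → b ∈ terr x → G.Adj p b → H.Adj q x :=
    fun hq hx hb hpb => (h.adj_iff (by rintro rfl; exact hx hq)).2 ⟨p, hq, _, hb, hpb⟩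
  rcases h.mem_of_adj ha hpa with hw | ⟨q, hq⟩
  · rcases h.mem_of_adj ha' hpa' with hw' | ⟨q, hq⟩
    · exact (hne (h.eq_of_mem hw hw')).elim
    · exact (hp (h.eq_of_mem (h.subset q hq) hw ▸ hq)).elim
  · exact ⟨q, hq, adj_of_mem hq hp ha hpa, adj_of_mem hq hp' ha' hpa'⟩

theorem of_equiv (e : W ≃ V) (he : ∀ w w', H.Adj w w' ↔ G.Adj (e w) (e w')) :
    G.HasTerritories H (fun w => {e w}) (fun w => {e w}) where
  nonempty _ := Set.singleton_nonempty _
  finite _ := Set.finite_singleton _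
  subset _ := subset_rfl
  disjoint _ _ hne := Set.disjoint_singleton.2 (e.injective.ne hne)
  mem_of_adj {_ _ p} _ _ := .inr ⟨e.symm p, (e.apply_symm_apply p).symm⟩
  adj_iff _ := by simpa using he _ _

/-- The deleted nodes need not be deleted one by one as long as none is a parent of another. The
territory of a deleted node is annexed by that of its only child. -/
theorem delete (h : G.HasTerritories H cl terr) {e : W' → W} (he : Function.Injective e)
    (not_adj : ∀ a ∉ Set.range e, ∀ b ∉ Set.range e, ¬ H.Adj a b)
    (eq_of_adj : ∀ a ∉ Set.range e, ∀ x y, H.Adj a x → H.Adj a y → x = y)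
    (adj_iff : ∀ w w', H'.Adj w w' ↔ H.Adj (e w) (e w') ∨
      ∃ a ∉ Set.range e, H.Adj (e w) a ∧ H.Adj a (e w')) :
    G.HasTerritories H' (fun w => cl (e w))
      (fun w => {n | ∃ x, (x = e w ∨ x ∉ Set.range e ∧ H.Adj x (e w)) ∧ n ∈ terr x}) where
  nonempty w := h.nonempty (e w)
  finite w := by
    have hfin : {x | x = e w ∨ x ∉ Set.range e ∧ H.Adj x (e w)}.Finite :=
      (insert (e w) (H.pa (e w) : Set W)).toFinite.subset fun x hx => hx.imp_right And.right
    refine (hfin.biUnion fun x _ => h.finite x).subset ?_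
    rintro n ⟨x, hx, hn⟩
    exact Set.mem_biUnion hx hn
  subset w n hn := ⟨e w, .inl rfl, h.subset _ hn⟩
  disjoint w w' hne := Set.disjoint_left.2 fun n ⟨x, hx, hn⟩ ⟨x', hx', hn'⟩ => by
    obtain rfl := h.eq_of_mem hn hn'
    rcases hx with rfl | ⟨hx, hw⟩ <;> rcases hx' with hx' | ⟨hx', hw'⟩
    · exact hne (he hx')
    · exact hx' ⟨w, rfl⟩
    · exact hx ⟨w', hx'.symm⟩
    · exact hne (he (eq_of_adj x hx _ _ hw hw'))
  mem_of_adj {w a p} := by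
    rintro ⟨x, hx, ha⟩ hp
    rcases h.mem_of_adj ha hp with hpx | ⟨q, hq⟩
    · exact .inl ⟨x, hx, hpx⟩
    by_cases hqe : q ∈ Set.range e
    · obtain ⟨w', rfl⟩ := hqe
      exact .inr ⟨w', hq⟩
    rcases eq_or_ne q x with rfl | hne
    · exact .inl ⟨q, hx, h.subset q hq⟩
    have hqx := (h.adj_iff hne).2 ⟨p, hq, a, ha, hp⟩
    rcases hx with rfl | ⟨hx, -⟩
    · exact .inl ⟨q, .inr ⟨hqe, hqx⟩, h.subset q hq⟩
    · exact (not_adj q hqe x hx hqx).elim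
  adj_iff {w w'} hne := by
    rw [adj_iff]
    constructor
    · rintro (hw | ⟨a, ha, hwa, haw⟩)
      · obtain ⟨p, hp, n, hn, hpn⟩ := (h.adj_iff (he.ne hne)).1 hw
        exact ⟨p, hp, n, ⟨e w', .inl rfl, hn⟩, hpn⟩
      · obtain ⟨p, hp, n, hn, hpn⟩ := (h.adj_iff (H.ne_of_adj hwa)).1 hwa
        exact ⟨p, hp, n, ⟨a, .inr ⟨ha, haw⟩, hn⟩, hpn⟩
    · rintro ⟨p, hp, n, ⟨x, rfl | ⟨hx, hxw⟩, hn⟩, hpn⟩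
      · exact .inl ((h.adj_iff (he.ne hne)).2 ⟨p, hp, n, hn, hpn⟩)
      · exact .inr ⟨x, hx, (h.adj_iff fun hwx => hx ⟨w, hwx⟩).2 ⟨p, hp, n, hn, hpn⟩, hxw⟩

theorem quotient (h : G.HasTerritories H cl terr) {f : W → W'} (hf : Function.Surjective f)
    (finite_fiber : ∀ w, {x | f x = w}.Finite)
    (adj_iff : ∀ w w', H'.Adj w w' ↔ w ≠ w' ∧ ∃ x y, f x = w ∧ f y = w' ∧ H.Adj x y) :
    G.HasTerritories H' (fun w => {n | ∃ x, f x = w ∧ n ∈ cl x})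
      (fun w => {n | ∃ x, f x = w ∧ n ∈ terr x}) where
  nonempty w := by
    obtain ⟨x, rfl⟩ := hf w
    exact (h.nonempty x).mono fun n hn => ⟨x, rfl, hn⟩
  finite w := ((finite_fiber w).biUnion fun x _ => h.finite x).subset fun n ⟨x, hx, hn⟩ =>
    Set.mem_biUnion hx hn
  subset w n := fun ⟨x, hx, hn⟩ => ⟨x, hx, h.subset x hn⟩
  disjoint w w' hne := Set.disjoint_left.2 fun n ⟨x, hx, hn⟩ ⟨x', hx', hn'⟩ =>
    hne (hx.symm.trans ((congrArg f (h.eq_of_mem hn hn')).trans hx'))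
  mem_of_adj {w a p} := fun ⟨x, hx, ha⟩ hp => (h.mem_of_adj ha hp).imp (fun hpx => ⟨x, hx, hpx⟩)
    fun ⟨q, hq⟩ => ⟨f q, q, rfl, hq⟩
  adj_iff {w w'} hne := by
    rw [adj_iff]
    constructor
    · rintro ⟨-, x, y, hx, hy, hxy⟩
      obtain ⟨p, hp, a, ha, hpa⟩ := (h.adj_iff (H.ne_of_adj hxy)).1 hxy
      exact ⟨p, ⟨x, hx, hp⟩, a, ⟨y, hy, ha⟩, hpa⟩
    · rintro ⟨p, ⟨x, rfl, hp⟩, a, ⟨y, rfl, ha⟩, hpa⟩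
      exact ⟨hne, x, y, rfl, rfl, (h.adj_iff (ne_of_apply_ne f hne)).2 ⟨p, hp, a, ha, hpa⟩⟩

end HasTerritories

theorem IsDeletion.notMem_range_iff {a b : W} {e : W' → W} (h : H.IsDeletion a H' e) :
    b ∉ Set.range e ↔ b = a := by
  rw [h.range_eq, Set.mem_compl_iff, not_not, Set.mem_singleton_iff]

theorem IsMerging.finite_fiber {a b : W} {f : W → W'} (h : H.IsMerging a b H' f) (w : W') :
    {x | f x = w}.Finite := by
  obtain ⟨y, rfl⟩ := h.surjective w
  refine ({y, a, b} : Set W).toFinite.subset fun x hx => ?_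
  rcases (h.eq_iff x y).1 hx with rfl | ⟨rfl, -⟩ | ⟨rfl, -⟩ <;> simp

namespace AbstractsTo

theorem exists_hasTerritories {X : Set V} (h : G.AbstractsTo X H cl) :
    ∃ terr, G.HasTerritories H cl terr := by
  induction h with
  | rename H e he => exact ⟨_, .of_equiv e he⟩
  | delete a e _ h ih =>
    obtain ⟨terr, ht⟩ := ih
    refine ⟨_, ht.delete h.injective ?_ ?_ fun w w' => ?_⟩
    · intro b hb b' hb' hadj
      exact ne_of_adj _ hadj ((h.notMem_range_iff.1 hb).trans (h.notMem_range_iff.1 hb').symm)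
    · intro b hb
      rw [h.notMem_range_iff.1 hb]
      exact h.not_confounder
    · simp only [h.notMem_range_iff, exists_eq_left, h.adj_iff]
  | merge a b f _ _ _ h ih =>
    obtain ⟨terr, ht⟩ := ih
    exact ⟨_, ht.quotient h.surjective h.finite_fiber h.adj_iff⟩

theorem disjoint_or_eq_singleton {X : Set V} (h : G.AbstractsTo X H cl) (w : W) :
    Disjoint (cl w) X ∨ ∃ x ∈ X, cl w = {x} := by
  induction h with
  | rename _ e _ =>
    by_cases hw : e w ∈ X
    · exact .inr ⟨e w, hw, rfl⟩
    · exact .inl (Set.disjoint_singleton_left.2 hw)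
  | delete _ e _ _ ih => exact ih (e w)
  | @merge W W' H cl H' a b f _ ha hb h ih =>
    obtain ⟨x, rfl⟩ := h.surjective w
    have cases_of_eq : ∀ {y}, f y = f x → y = x ∨ Disjoint (cl y) X ∧ Disjoint (cl x) X := by
      intro y hy
      rcases (h.eq_iff y x).1 hy with rfl | ⟨rfl, rfl⟩ | ⟨rfl, rfl⟩
      exacts [.inl rfl, .inr ⟨ha, hb⟩, .inr ⟨hb, ha⟩]
    refine (ih x).imp (fun hx => ?_) fun ⟨v, hv, hx⟩ => ⟨v, hv, ?_⟩
    · rw [Set.disjoint_left]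
      rintro n ⟨y, hy, hn⟩
      obtain rfl | ⟨hy, -⟩ := cases_of_eq hy
      exacts [Set.disjoint_left.1 hx hn, Set.disjoint_left.1 hy hn]
    · have not_disjoint : ¬ Disjoint (cl x) X := Set.not_disjoint_iff.2 ⟨v, by simp [hx], hv⟩
      refine Set.ext fun n => ⟨fun ⟨y, hy, hn⟩ => ?_, fun hn => ⟨x, rfl, hx ▸ hn⟩⟩
      obtain rfl := (cases_of_eq hy).resolve_right fun hdisj => not_disjoint hdisj.2
      rwa [← hx]

end AbstractsTo

end DAG

namespace DAG

variable {V U W : Type u}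

section Represents

variable {G : DAG (V ⊕ U)} {L : ADMG V}

theorem latentPath_iff_adj (hG : ∀ u, G.pa (Sum.inr u) = ∅) {x : V ⊕ U} {v : V} :
    G.LatentPath x v ↔ G.Adj x (Sum.inl v) := by
  refine ⟨fun h => ?_, .edge⟩
  cases h with
  | edge h => exact h
  | step h _ => simp [Adj, hG] at h

theorem represents_iff : G.Represents L ↔ (∀ u, G.pa (Sum.inr u) = ∅) ∧
    (∀ v w, L.Dir v w ↔ G.Adj (Sum.inl v) (Sum.inl w)) ∧
    ∀ v w, L.Bidir v w ↔
      v ≠ w ∧ ∃ u, G.Adj (Sum.inr u) (Sum.inl v) ∧ G.Adj (Sum.inr u) (Sum.inl w) := by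
  constructor
  · rintro ⟨hG, rfl⟩
    simp only [latentProjection, latentPath_iff_adj hG, implies_true, and_true]
    exact hG
  · rintro ⟨hG, hdir, hbidir⟩
    refine ⟨hG, ADMG.ext ?_ ?_⟩
    · ext v w
      exact (latentPath_iff_adj hG).trans (hdir v w).symm
    · ext v w
      simp only [latentProjection, latentPath_iff_adj hG, hbidir]

theorem Represents.dir_iff (h : G.Represents L) {v w : V} :
    L.Dir v w ↔ G.Adj (Sum.inl v) (Sum.inl w) :=
  (represents_iff.1 h).2.1 v w

theorem Represents.bidir_iff (h : G.Represents L) {v w : V} : L.Bidir v w ↔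
    v ≠ w ∧ ∃ u, G.Adj (Sum.inr u) (Sum.inl v) ∧ G.Adj (Sum.inr u) (Sum.inl w) :=
  (represents_iff.1 h).2.2 v w

theorem Represents.not_adj_inr (h : G.Represents L) (x : V ⊕ U) (u : U) :
    ¬ G.Adj x (Sum.inr u) := by
  simp [Adj, h.exogenous u]

theorem Represents.finite_setOf_dir (h : G.Represents L) (v : V) : {w | L.Dir w v}.Finite := by
  simp only [h.dir_iff]
  exact (G.pa (Sum.inl v)).finite_toSet.preimage Sum.inl_injective.injOn

theorem Represents.exists_adj_inl (h : G.Represents L) {x y : V ⊕ U} (hxy : G.Adj x y) :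
    ∃ v, y = Sum.inl v := by
  rcases y with v | u
  · exact ⟨v, rfl⟩
  · exact (h.not_adj_inr x u hxy).elim

end Represents

/-- The subgraph of `G` induced on the image of `e`, with the node names of the domain of `e`. -/
noncomputable def comap (G : DAG V) (e : W ↪ V) : DAG W where
  pa w := (G.pa (e w)).preimage e e.injective.injOn
  acyclic w h := G.acyclic (e w) (h.lift e fun _ _ => Finset.mem_preimage.1)

theorem comap_adj (G : DAG V) (e : W ↪ V) {w w' : W} :
    (G.comap e).Adj w w' ↔ G.Adj (e w) (e w') := by
  simp [Adj, comap]

theorem HasTerritories.exists_comap {G : DAG V} {H : DAG W} {cl terr : W → Set V}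
    (h : G.HasTerritories H cl terr) {Q : Type u} (e : Q ↪ W)
    (not_adj : ∀ a ∉ Set.range e, ∀ x, ¬ H.Adj x a)
    (eq_of_adj : ∀ a ∉ Set.range e, ∀ x y, H.Adj a x → H.Adj a y → x = y) :
    ∃ terr', G.HasTerritories (H.comap e) (fun q => cl (e q)) terr' := by
  refine ⟨_, h.delete e.injective (fun a _ b hb => not_adj b hb a) eq_of_adj fun q q' => ?_⟩
  rw [comap_adj, or_iff_left]
  rintro ⟨a, ha, hqa, -⟩
  exact not_adj a ha _ hqa

end DAG

namespace ADMG

variable {V U W P : Type u}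

/-- The DAG with the directed edges of the ADMG `H` and, for every `u : U`, an exogenous node with
the children `w` such that `c u w`. -/
noncomputable def withExogenous (H : ADMG W) (c : U → W → Prop)
    (hH : ∀ w, {w' | H.Dir w' w}.Finite) (hc : ∀ w, {u | c u w}.Finite) : DAG (W ⊕ U) where
  pa := Sum.elim (fun w => (hH w).toFinset.disjSum (hc w).toFinset) fun _ => ∅
  acyclic x hx := by
    have transGen_dir : ∀ {w y}, Relation.TransGen (fun x y => x ∈ Sum.elim
        (fun w => (hH w).toFinset.disjSum (hc w).toFinset) (fun _ => (∅ : Finset (W ⊕ U))) y)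
          (Sum.inl w) y → ∃ w', y = Sum.inl w' ∧ Relation.TransGen H.Dir w w' := by
      intro w y h
      induction h with
      | @single y h =>
        rcases y with w' | u
        · exact ⟨w', rfl, .single (by simpa using h)⟩
        · simp at h
      | @tail _ y _ h ih =>
        obtain ⟨w', rfl, hw'⟩ := ih
        rcases y with w'' | u
        · exact ⟨w'', rfl, hw'.tail (by simpa using h)⟩
        · simp at h
    rcases x with w | u
    · obtain ⟨w', hw', hw⟩ := transGen_dir hx
      exact H.acyclic w (by rwa [← Sum.inl_injective hw'] at hw)
    · obtain ⟨y, -, hy⟩ := Relation.TransGen.tail'_iff.1 hx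
      simp at hy

section WithExogenous

variable {H : ADMG W} {c : U → W → Prop} {hH : ∀ w, {w' | H.Dir w' w}.Finite}
  {hc : ∀ w, {u | c u w}.Finite}

theorem withExogenous_adj_inl_inl {w w' : W} :
    (H.withExogenous c hH hc).Adj (Sum.inl w) (Sum.inl w') ↔ H.Dir w w' := by
  simp [DAG.Adj, withExogenous]

theorem withExogenous_adj_inr_inl {u : U} {w : W} :
    (H.withExogenous c hH hc).Adj (Sum.inr u) (Sum.inl w) ↔ c u w := by
  simp [DAG.Adj, withExogenous]

theorem withExogenous_not_adj_inr {x : W ⊕ U} {u : U} :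
    ¬ (H.withExogenous c hH hc).Adj x (Sum.inr u) := by
  simp [DAG.Adj, withExogenous]

theorem withExogenous_represents
    (hbidir : ∀ w w', H.Bidir w w' ↔ w ≠ w' ∧ ∃ u, c u w ∧ c u w') :
    (H.withExogenous c hH hc).Represents H :=
  DAG.represents_iff.2 ⟨fun _ => rfl, fun _ _ => withExogenous_adj_inl_inl.symm, by
    simpa only [withExogenous_adj_inr_inl] using hbidir⟩

end WithExogenous

/-- The analogue of `DAG.HasTerritories` for ADMGs: the bidirected edges of `H` are those between
the territories of its nodes. -/
structure HasTerritories (L : ADMG V) (H : ADMG W) (cl terr : W → Set V) : Prop where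
  nonempty : ∀ w, (cl w).Nonempty
  finite : ∀ w, (terr w).Finite
  subset : ∀ w, cl w ⊆ terr w
  disjoint : Pairwise (Function.onFun Disjoint terr)
  mem_of_dir : ∀ {w a p}, a ∈ terr w → L.Dir p a → p ∈ terr w ∨ ∃ w', p ∈ cl w'
  dir_iff : ∀ {w w'}, w ≠ w' → (H.Dir w w' ↔ ∃ p ∈ cl w, ∃ a ∈ terr w', L.Dir p a)
  bidir_iff : ∀ {w w'}, w ≠ w' → (H.Bidir w w' ↔ ∃ a ∈ terr w, ∃ a' ∈ terr w', L.Bidir a a')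

end ADMG

namespace DAG.HasTerritories

variable {V U W R : Type u} {G : DAG (V ⊕ U)} {L : ADMG V} {H₁ : DAG (W ⊕ R)} {H : ADMG W}
  {cl terr : W ⊕ R → Set (V ⊕ U)}

theorem bidir_iff (h : G.HasTerritories H₁ cl terr) (hG : G.Represents L) (hH : H₁.Represents H)
    (cl_inl : ∀ w, Disjoint (cl (Sum.inl w)) (Set.range Sum.inr))
    (cl_inr : ∀ r, ∃ u, cl (Sum.inr r) = {Sum.inr u}) {w w' : W} (hne : w ≠ w') :
    H.Bidir w w' ↔ ∃ v ∈ Sum.inl ⁻¹' terr (Sum.inl w), ∃ v' ∈ Sum.inl ⁻¹' terr (Sum.inl w'),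
      L.Bidir v v' := by
  rw [hH.bidir_iff]
  constructor
  · rintro ⟨-, r, hw, hw'⟩
    obtain ⟨u, hu⟩ := cl_inr r
    have exists_child : ∀ {x}, H₁.Adj (Sum.inr r) (Sum.inl x) →
        ∃ v, Sum.inl v ∈ terr (Sum.inl x) ∧ G.Adj (Sum.inr u) (Sum.inl v) := by
      intro x hx
      obtain ⟨p, hp, y, hy, hpy⟩ := (h.adj_iff Sum.inr_ne_inl).1 hx
      obtain ⟨v, rfl⟩ := hG.exists_adj_inl hpy
      obtain rfl : p = Sum.inr u := by rwa [hu] at hp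
      exact ⟨v, hy, hpy⟩
    obtain ⟨v, hv, huv⟩ := exists_child hw
    obtain ⟨v', hv', huv'⟩ := exists_child hw'
    refine ⟨v, hv, v', hv', hG.bidir_iff.2 ⟨?_, u, huv, huv'⟩⟩
    rintro rfl
    exact hne (Sum.inl_injective (h.eq_of_mem hv hv'))
  · rintro ⟨v, hv, v', hv', hvv'⟩
    obtain ⟨-, u, hu, hu'⟩ := hG.bidir_iff.1 hvv'
    have notMem_cl : ∀ x, Sum.inr u ∉ cl (Sum.inl x) := fun x hx =>
      Set.disjoint_left.1 (cl_inl x) hx ⟨u, rfl⟩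
    obtain ⟨x | r, hq, hw, hw'⟩ := h.exists_adj_of_common_parent (Sum.inl_injective.ne hne)
      hv hv' hu hu' (notMem_cl w) (notMem_cl w')
    · exact (notMem_cl x hq).elim
    · exact ⟨hne, r, hw, hw'⟩

theorem admgHasTerritories
    (h : G.HasTerritories H₁ cl terr) (hG : G.Represents L) (hH : H₁.Represents H)
    (cl_inl : ∀ w, Disjoint (cl (Sum.inl w)) (Set.range Sum.inr))
    (cl_inr : ∀ r, ∃ u, cl (Sum.inr r) = {Sum.inr u}) :
    L.HasTerritories H (fun w => Sum.inl ⁻¹' cl (Sum.inl w))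
      (fun w => Sum.inl ⁻¹' terr (Sum.inl w)) where
  nonempty w := by
    obtain ⟨v | u, hv⟩ := h.nonempty (Sum.inl w)
    · exact ⟨v, hv⟩
    · exact (Set.disjoint_left.1 (cl_inl w) hv ⟨u, rfl⟩).elim
  finite w := (h.finite _).preimage Sum.inl_injective.injOn
  subset w := Set.preimage_mono (h.subset _)
  disjoint w w' hne := (h.disjoint (Sum.inl_injective.ne hne)).preimage _
  mem_of_dir {w a p} ha hp := by
    refine (h.mem_of_adj ha (hG.dir_iff.1 hp)).imp_right fun ⟨q, hq⟩ => ?_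
    rcases q with w' | r
    · exact ⟨w', hq⟩
    · obtain ⟨u, hu⟩ := cl_inr r
      simp [hu] at hq
  dir_iff {w w'} hne := by
    rw [hH.dir_iff, h.adj_iff (Sum.inl_injective.ne hne)]
    constructor
    · rintro ⟨v | u, hv, y, hy, hvy⟩
      · obtain ⟨v', rfl⟩ := hG.exists_adj_inl hvy
        exact ⟨v, hv, v', hy, hG.dir_iff.2 hvy⟩
      · exact (Set.disjoint_left.1 (cl_inl w) hv ⟨u, rfl⟩).elim
    · rintro ⟨v, hv, v', hv', hvv'⟩
      exact ⟨_, hv, _, hv', hG.dir_iff.1 hvv'⟩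
  bidir_iff := h.bidir_iff hG hH cl_inl cl_inr

end DAG.HasTerritories

namespace ADMG

variable {V U W P : Type u}

namespace HasTerritories

variable {L : ADMG V} {H : ADMG W} {cl terr : W → Set V}

theorem eq_of_mem (h : L.HasTerritories H cl terr) {w w' : W} {v : V} (hv : v ∈ terr w)
    (hv' : v ∈ terr w') : w = w' :=
  h.disjoint.eq (Set.not_disjoint_iff.2 ⟨v, hv, hv'⟩)

theorem finite_setOf_dir (h : L.HasTerritories H cl terr) (hL : ∀ v, {p | L.Dir p v}.Finite)
    (w : W) : {w' | H.Dir w' w}.Finite := by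
  have finite_cl : ∀ p, {w' | p ∈ cl w'}.Finite := fun p =>
    Set.Subsingleton.finite fun _ hx _ hy => h.eq_of_mem (h.subset _ hx) (h.subset _ hy)
  refine ((h.finite w).biUnion fun a _ => (hL a).biUnion fun p _ => finite_cl p).subset ?_
  intro w' hw'
  have hne : w' ≠ w := by
    rintro rfl
    exact H.acyclic w' (.single hw')
  obtain ⟨p, hp, a, ha, hpa⟩ := (h.dir_iff hne).1 hw'
  exact Set.mem_biUnion ha (Set.mem_biUnion hpa hp)

theorem finite_setOf_adj (h : L.HasTerritories H cl terr) (G : DAG (V ⊕ U)) (w : W) :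
    {u | ∃ v ∈ terr w, G.Adj (Sum.inr u) (Sum.inl v)}.Finite := by
  refine ((h.finite w).biUnion fun v _ =>
    (G.pa (Sum.inl v)).finite_toSet.preimage Sum.inr_injective.injOn).subset ?_
  rintro u ⟨v, hv, huv⟩
  exact Set.mem_biUnion hv huv

/-- The territories of the exogenous nodes of `G` are trivial. -/
theorem withExogenous (h : L.HasTerritories H cl terr) {G : DAG (V ⊕ U)} (hG : G.Represents L)
    (hH : ∀ w, {w' | H.Dir w' w}.Finite) :
    G.HasTerritories (H.withExogenous _ hH (h.finite_setOf_adj G))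
      (Sum.elim (fun w => Sum.inl '' cl w) fun u => {Sum.inr u})
      (Sum.elim (fun w => Sum.inl '' terr w) fun u => {Sum.inr u}) where
  nonempty := by
    rintro (w | u)
    exacts [(h.nonempty w).image _, Set.singleton_nonempty _]
  finite := by
    rintro (w | u)
    exacts [(h.finite w).image _, Set.finite_singleton _]
  subset := by
    rintro (w | u)
    exacts [Set.image_mono (h.subset w), subset_rfl]
  disjoint := by
    rintro (w | u) (w' | u') hne
    · exact (Set.disjoint_image_iff Sum.inl_injective).2 (h.disjoint (ne_of_apply_ne _ hne))
    · simp [Function.onFun]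
    · simp [Function.onFun]
    · simpa [Function.onFun, eq_comm] using hne
  mem_of_adj := by
    rintro (w | u) a p ha hp
    · obtain ⟨v, hv, rfl⟩ := ha
      rcases p with v' | u
      · refine (h.mem_of_dir hv (hG.dir_iff.2 hp)).imp (fun hv' => ⟨v', hv', rfl⟩) ?_
        rintro ⟨w', hw'⟩
        exact ⟨Sum.inl w', v', hw', rfl⟩
      · exact .inr ⟨Sum.inr u, rfl⟩
    · obtain rfl := ha
      exact (hG.not_adj_inr p u hp).elim
  adj_iff := by
    rintro (w | u) (w' | u') hne
    · simp [withExogenous_adj_inl_inl, h.dir_iff (ne_of_apply_ne _ hne), hG.dir_iff]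
    · simp [hG.not_adj_inr, withExogenous_not_adj_inr]
    · simp [withExogenous_adj_inr_inl]
    · simp [hG.not_adj_inr, withExogenous_not_adj_inr]

theorem withExogenous_represents (h : L.HasTerritories H cl terr) {G : DAG (V ⊕ U)}
    (hG : G.Represents L) (hH : ∀ w, {w' | H.Dir w' w}.Finite) :
    (H.withExogenous _ hH (h.finite_setOf_adj G)).Represents H := by
  refine ADMG.withExogenous_represents fun w w' => ⟨fun hww' => ?_, ?_⟩
  · have hne : w ≠ w' := fun e => H.irrefl w (by rwa [← e] at hww')
    obtain ⟨v, hv, v', hv', hvv'⟩ := (h.bidir_iff hne).1 hww'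
    obtain ⟨-, u, hu, hu'⟩ := hG.bidir_iff.1 hvv'
    exact ⟨hne, u, ⟨v, hv, hu⟩, v', hv', hu'⟩
  · rintro ⟨hne, u, ⟨v, hv, hu⟩, v', hv', hu'⟩
    refine (h.bidir_iff hne).2 ⟨v, hv, v', hv', hG.bidir_iff.2 ⟨?_, u, hu, hu'⟩⟩
    rintro rfl
    exact hne (h.eq_of_mem hv hv')

end HasTerritories

end ADMG

namespace ADMG

variable {V U W P R : Type u}

/-- `H` results from `L` by declaring the nodes `P`, which must not have incoming directed edges or
bidirected ones, to be exogenous. -/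
structure ProjectsTo (L : ADMG (W ⊕ P)) (H : ADMG W) : Prop where
  not_dir_inr : ∀ {x p}, ¬ L.Dir x (Sum.inr p)
  not_bidir_inr : ∀ {x p}, ¬ L.Bidir x (Sum.inr p)
  dir_iff : ∀ {w w'}, H.Dir w w' ↔ L.Dir (Sum.inl w) (Sum.inl w')
  bidir_iff : ∀ {w w'}, H.Bidir w w' ↔ L.Bidir (Sum.inl w) (Sum.inl w') ∨
    w ≠ w' ∧ ∃ p, L.Dir (Sum.inr p) (Sum.inl w) ∧ L.Dir (Sum.inr p) (Sum.inl w')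

end ADMG

namespace DAG

variable {V U W P R : Type u}

theorem Represents.exists_projectsTo {G : DAG (W ⊕ U)} {H : ADMG W} (h : G.Represents H)
    (i : P ⊕ R ≃ U) :
    ∃ L : ADMG (W ⊕ P), (G.comap ((Equiv.sumAssoc W P R).trans
      ((Equiv.refl W).sumCongr i)).toEmbedding).Represents L ∧ L.ProjectsTo H := by
  set G' := G.comap ((Equiv.sumAssoc W P R).trans ((Equiv.refl W).sumCongr i)).toEmbedding
  have adj_inl {w w' : W} : G'.Adj (.inl (.inl w)) (.inl (.inl w')) ↔ H.Dir w w' :=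
    (comap_adj ..).trans h.dir_iff.symm
  have not_adj_inl_inr (x) (p : P) : ¬ G'.Adj x (.inl (.inr p)) := fun hx =>
    h.not_adj_inr _ _ ((comap_adj ..).1 hx)
  have not_adj_inr (x) (r : R) : ¬ G'.Adj x (.inr r) := fun hx =>
    h.not_adj_inr _ _ ((comap_adj ..).1 hx)
  have hL : G'.Represents G'.latentProjection :=
    ⟨fun r => Finset.eq_empty_of_forall_notMem fun x => not_adj_inr x r, rfl⟩
  refine ⟨G'.latentProjection, hL, ?_, ?_, ?_, ?_⟩
  · exact fun hx => not_adj_inl_inr _ _ (hL.dir_iff.1 hx)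
  · intro x p hx
    obtain ⟨-, r, -, hr⟩ := hL.bidir_iff.1 hx
    exact not_adj_inl_inr _ _ hr
  · exact adj_inl.symm.trans hL.dir_iff.symm
  · intro w w'
    simp only [h.bidir_iff, hL.bidir_iff, hL.dir_iff, ne_eq, Sum.inl.injEq, ← and_or_left,
      ← i.exists_congr_right, Sum.exists, G', comap_adj]
    simp [or_comm]

/-- The inclusion of all nodes but the exogenous ones that do not belong to `S`, where `P` is
regarded as exogenous in the domain. -/
def regroup (W P : Type u) (S : Set U) : W ⊕ (P ⊕ S) ↪ (W ⊕ P) ⊕ U where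
  toFun := Sum.elim (fun w => .inl (.inl w)) (Sum.elim (fun p => .inl (.inr p)) fun u => .inr u.1)
  inj' := by rintro (w | p | u) (w' | p' | u') <;> simp [Subtype.ext_iff]

theorem coe_regroup (S : Set U) : ⇑(regroup W P S) = Sum.elim (fun w => Sum.inl (Sum.inl w))
    (Sum.elim (fun p => Sum.inl (Sum.inr p)) fun u => Sum.inr u.1) := rfl

theorem notMem_range_regroup {S : Set U} {x : (W ⊕ P) ⊕ U} :
    x ∉ Set.range (regroup W P S) ↔ ∃ u ∉ S, x = Sum.inr u := by
  rcases x with (w | p) | u <;> simp [coe_regroup, Set.Sum.elim_range]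

end DAG

namespace ADMG.ProjectsTo

open DAG

variable {V U W P : Type u} {L : ADMG (W ⊕ P)} {H : ADMG W} {G : DAG ((W ⊕ P) ⊕ U)}

theorem eq_of_adj (h : L.ProjectsTo H) (hG : G.Represents L) {u : U} {p : P}
    (hp : G.Adj (Sum.inr u) (Sum.inl (Sum.inr p))) {x : (W ⊕ P) ⊕ U} (hx : G.Adj (Sum.inr u) x) :
    x = Sum.inl (Sum.inr p) := by
  obtain ⟨v, rfl⟩ := hG.exists_adj_inl hx
  by_contra hne
  exact h.not_bidir_inr (hG.bidir_iff.2 ⟨ne_of_apply_ne _ hne, u, hx, hp⟩)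

theorem represents_comap_regroup (h : L.ProjectsTo H) (hG : G.Represents L) :
    (G.comap (regroup W P {u | ∀ p, ¬ G.Adj (Sum.inr u) (Sum.inl (Sum.inr p))})).Represents H := by
  refine represents_iff.2 ⟨?_, fun w w' => ?_, fun w w' => ?_⟩
  · rintro (p | u) <;> refine Finset.eq_empty_of_forall_notMem fun x hx => ?_
    · rcases x with w | q | u
      · exact h.not_dir_inr (hG.dir_iff.2 ((comap_adj ..).1 hx))
      · exact h.not_dir_inr (hG.dir_iff.2 ((comap_adj ..).1 hx))
      · exact u.2 p ((comap_adj ..).1 hx)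
    · exact hG.not_adj_inr _ _ ((comap_adj ..).1 hx)
  · rw [h.dir_iff, hG.dir_iff, comap_adj]
    rfl
  · have mem_of_adj : ∀ {u}, G.Adj (Sum.inr u) (Sum.inl (Sum.inl w)) →
        ∀ p, ¬ G.Adj (Sum.inr u) (Sum.inl (Sum.inr p)) := fun hu p hp => by
      simpa using h.eq_of_adj hG hp hu
    simp only [h.bidir_iff, hG.bidir_iff, hG.dir_iff, comap_adj, coe_regroup, Sum.exists,
      Sum.elim_inl, Sum.elim_inr, ne_eq, Sum.inl.injEq, ← and_or_left, Subtype.exists]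
    rw [or_comm]
    refine and_congr_right fun _ => or_congr_right (exists_congr fun u => ?_)
    exact ⟨fun hu => ⟨mem_of_adj hu.1, hu⟩, fun ⟨_, hu⟩ => hu⟩

theorem exists_hasTerritories_comap_regroup {G' : DAG V} {cl terr : (W ⊕ P) ⊕ U → Set V}
    (h : L.ProjectsTo H) (hG : G.Represents L) (ht : G'.HasTerritories G cl terr) :
    ∃ terr', G'.HasTerritories
      (G.comap (regroup W P {u | ∀ p, ¬ G.Adj (Sum.inr u) (Sum.inl (Sum.inr p))}))
      (fun x => cl (regroup W P _ x)) terr' := by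
  refine ht.exists_comap _ (fun a ha x hx => ?_) fun a ha x y hx hy => ?_ <;>
    obtain ⟨u, hu, rfl⟩ := notMem_range_regroup.1 ha
  · exact hG.not_adj_inr _ _ hx
  · obtain ⟨p, hp⟩ := not_forall_not.1 hu
    exact (h.eq_of_adj hG hp hx).trans (h.eq_of_adj hG hp hy).symm

end ADMG.ProjectsTo

theorem ADMG.IsGraphicalAbstraction.exists_hasTerritories {V U W : Type u} [Finite U]
    {L : ADMG V} {H : ADMG W} {K : W → Set V} (hH : L.IsGraphicalAbstraction H K)
    {G : DAG (V ⊕ U)} (hG : G.Represents L) :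
    ∃ (U' : Type u) (_ : Finite U') (H' : DAG (W ⊕ U')) (cl terr : W ⊕ U' → Set (V ⊕ U)),
      H'.Represents H ∧ G.HasTerritories H' cl terr ∧ ∀ w, cl (Sum.inl w) = Sum.inl '' K w := by
  classical
  obtain ⟨U₁, U₂, -, _, L₁, H₁, cl, hL₁, hH₁, habs, hcl⟩ := hH
  let i := Equiv.sumCompl fun p => Disjoint (cl (Sum.inr p)) (Set.range Sum.inr)
  let e := (Equiv.sumAssoc W _ _).trans ((Equiv.refl W).sumCongr i)
  obtain ⟨N, hN, hproj⟩ := hH₁.exists_projectsTo i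
  obtain ⟨terr, ht⟩ := habs.exists_hasTerritories
  obtain ⟨terr₁, ht₁⟩ := ht.exists_comap e.toEmbedding
    (fun a ha => (ha (e.surjective a)).elim) (fun a ha => (ha (e.surjective a)).elim)
  have cl_inl : ∀ x, Disjoint (cl (e (Sum.inl x))) (Set.range Sum.inr) := by
    rintro (w | p)
    · simp [e, hcl]
    · exact p.2
  have cl_inr : ∀ r, ∃ u, cl (e (Sum.inr r)) = {Sum.inr u} := fun r => by
    obtain ⟨_, ⟨u, rfl⟩, hu⟩ := (habs.disjoint_or_eq_singleton _).resolve_left r.2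
    exact ⟨u, hu⟩
  have htN := ht₁.admgHasTerritories hL₁ hN cl_inl cl_inr
  have finite_dir := htN.finite_setOf_dir hG.finite_setOf_dir
  have hrep := htN.withExogenous_represents hG finite_dir
  obtain ⟨terr', ht'⟩ :=
    hproj.exists_hasTerritories_comap_regroup hrep (htN.withExogenous hG finite_dir)
  refine ⟨_, inferInstance, _, _, terr', hproj.represents_comap_regroup hrep, ht', fun w => ?_⟩
  change Sum.inl '' (Sum.inl ⁻¹' cl (Sum.inl w)) = _
  rw [hcl, Set.preimage_image_eq _ Sum.inl_injective]

theorem mainTheorem7_general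
    {V U W : Type u} [Finite U]
    {M : Type u₁} [Category.{v₁} M] [MonoidalCategory.{v₁} M] [MarkovCategory M]
    (L : ADMG V) (L' : DAG (V ⊕ U)) (F : CausalModel L' M) (hF : F.IsOverADMG L)
    (H : ADMG W) (K : W → Set (V ⊕ U))
    (hH : (∃ K₀ : W → Set V, L.IsGraphicalAbstraction H K₀ ∧ ∀ w, K w = Sum.inl '' K₀ w) ∨
      L'.HasADMGAbstraction H K) :
    ∃ (U' : Type u) (_ : Finite U') (H' : DAG (W ⊕ U'))
      (ι : MarkovFunctor (FreeMarkov H') (FreeMarkov L')),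
      ι.EmbedsRestr ∧
      (∀ w : W, {n | n ∈ (ι.toFunctor.obj (FreeMarkov.of (Sum.inl w))).nodes} = K w) ∧
      (F.restrict ι).IsOverADMG H := by
  rcases hH with ⟨K₀, hH, hK⟩ | ⟨U', hU', H', cl, hH', habs, hcl⟩
  · obtain ⟨U', hU', H', cl, terr, hH', ht, hcl⟩ := hH.exists_hasTerritories hF
    obtain ⟨ι, hι, hιcl⟩ := ht.exists_markovFunctor
    exact ⟨U', hU', H', ι, hι, fun w => by rw [hιcl, hcl, hK], hH'⟩
  · obtain ⟨terr, ht⟩ := habs.exists_hasTerritories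
    obtain ⟨ι, hι, hιcl⟩ := ht.exists_markovFunctor
    exact ⟨U', hU', H', ι, hι, fun w => by rw [hιcl, hcl], hH'⟩

theorem mainTheorem7
    {V U W : Type u} [Finite V] [Finite U]
    {M : Type u₁} [Category.{v₁} M] [MonoidalCategory.{v₁} M] [MarkovCategory M]
    (L : ADMG V) (L' : DAG (V ⊕ U)) (F : CausalModel L' M) (hF : F.IsOverADMG L)
    (H : ADMG W) (K : W → Set (V ⊕ U))
    (hH : (∃ K₀ : W → Set V, L.IsGraphicalAbstraction H K₀ ∧ ∀ w, K w = Sum.inl '' K₀ w) ∨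
      L'.HasADMGAbstraction H K) :
    ∃ (U' : Type u) (_ : Finite U') (H' : DAG (W ⊕ U'))
      (ι : MarkovFunctor (FreeMarkov H') (FreeMarkov L')),
      ι.EmbedsRestr ∧
      (∀ w : W, {n | n ∈ (ι.toFunctor.obj (FreeMarkov.of (Sum.inl w))).nodes} = K w) ∧
      (F.restrict ι).IsOverADMG H :=
  mainTheorem7_general L L' F hF H K hH
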